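/- Let $\gamma$ be the Euler–Mascheroni constant, $\operatorname{Si}(z)=\int_0^z\frac{\sin t}{t}\,dt$ the sine integral, and $${}_pF_q\!\left[\begin{matrix}a_1,\dots,a_p\\ b_1,\dots,b_q\end{matrix};x\right]=\sum_{n\ge 0}\frac{(a_1)_n\cdots(a_p)_n}{(b_1)_n\cdots(b_q)_n}\,\frac{x^n}{n!},\qquad (a)_n=a(a+1)\cdots(a+n-1),$$ the generalized hypergeometric function. Let $A$ be the Glaisher–Kinkelin constant, $$A=\lim_{n\to\infty}\frac{H(n)\,e^{n^2/4}}{n^{n^2/2+n/2+1/12}},\qquad H(n)=\prod_{k=1}^n k^k .$$ This limit exists and is positive, and $$\ln A=\frac1{12}\left[\ln(2\pi)+\gamma+\frac{11}{2\pi^2}\right]+\sum_{k=1}^\infty\Bigg[k(\gamma-1)+\frac{13}{12\pi^2}\left(\frac1{2\pi^2k^2}-1\right)+\frac{8}{9\pi^2}\left({}_1F_2\!\left[\begin{matrix}-\frac12\\ \frac12,\frac52\end{matrix};-k^2\pi^2\right]+3\;{}_2F_3\!\left[\begin{matrix}-\frac12,-\frac12\\ \frac12,\frac12,\frac52\end{matrix};-k^2\pi^2\right]\right)+k\ln(2\pi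 k)-\frac{13k}{6\pi}\operatorname{Si}(2k\pi)\Bigg],$$ where the series on the right converges absolutely. -/

import Mathlib

/-- The hyperfactorial `H(n) = ∏_{k=1}^n k^k`. -/
def hyperfactorial (n : ℕ) : ℕ := ∏ k ∈ Finset.Icc 1 n, k ^ k

/-- The sequence `H(n) e^{n²/4} / n^{n²/2 + n/2 + 1/12}`. -/
noncomputable def glaisherSeq (n : ℕ) : ℝ :=
  (hyperfactorial n : ℝ) / (n : ℝ) ^ ((n : ℝ) ^ 2 / 2 + (n : ℝ) / 2 + 1 / 12)
    * Real.exp ((n : ℝ) ^ 2 / 4)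

/-- The Glaisher–Kinkelin constant `A`, the limit of `glaisherSeq`. -/
noncomputable def glaisherKinkelin : ℝ := Filter.limUnder Filter.atTop glaisherSeq

/-- The sine integral `Si(z) = ∫_0^z sin t / t dt`. -/
noncomputable def sineIntegral (z : ℝ) : ℝ := ∫ t in (0 : ℝ)..z, Real.sin t / t

/-- The `n`-th term of the generalized hypergeometric series `pFq[as; bs; x]`, that is
`((a₁)_n ⋯ (a_p)_n) / ((b₁)_n ⋯ (b_q)_n) * x^n / n!`,
where `(a)_n = a (a+1) ⋯ (a+n-1)` is the value of `ascPochhammer ℝ n` at `a`. -/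
noncomputable def hypergeometricTerm (as bs : List ℝ) (x : ℝ) (n : ℕ) : ℝ :=
  (as.map (fun a => (ascPochhammer ℝ n).eval a)).prod
    / (bs.map (fun b => (ascPochhammer ℝ n).eval b)).prod
    * (x ^ n / (n.factorial : ℝ))

/-- The generalized hypergeometric function `pFq[as; bs; x]`, as the sum of its power series
(which converges for every `x` if `p ≤ q` and no lower parameter is a nonpositive integer). -/
noncomputable def hypergeometric (as bs : List ℝ) (x : ℝ) : ℝ :=
  ∑' n : ℕ, hypergeometricTerm as bs x n

section

open Filter Set MeasureTheory Topology

/-! Put f(x) = log x / x², so that -f''(x) = (5 - 6 log x)/x⁴, and let B₂ be the periodic function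
{x}² - {x} + 1/6. The k-th summand is (4π⁴k²)⁻¹ times the integral of -f''(x) cos(2πkx) over x > 1
(`term_eq_integral`). Since ∑ cos(2πkx)/k² = π² B₂(x), summation under the integral leaves the
integral of -f'' B₂, an Euler–Maclaurin remainder equal to 2 ∑ log n / n² - 11/6. The theorem is
thereby reduced to log A = (log 2π + γ)/12 + (∑ log n / n²)/(2π²).

The same Fourier series gives this value. By `log_glaisherSeq_eq`, the logarithm of the N-th term of
the defining sequence is half the integral of (1/6 - B₂(x))/x over [0, N], minus (log N)/12.
Termwise, that integral is π⁻² ∑ Cin(2πkN)/k² with Cin(y) = ∫_0^y (1 - cos t) dt/t, and Cin(y) = log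
y + γ + O(1/y).

For the closed form of a summand, let T(y) = ∫_0^y Si(t) dt/t. Partial fractions of the
hypergeometric coefficients bring in only sin, cos, Si and T at 2πk; four integrations by parts
bring the cosine integral to the same functions, once Si → π/2 and T(y) - (π/2) log y → πγ/2 are
known.

The constants in these asymptotics come from an Abelian argument. Bounds on derivatives show that
each limit exists; its value is read off from the exponential mean a ∫ e^{-at} φ(t) dt as a → 0,
which is explicit for Si, Cin and T. -/

/-! ### Primitives against dt/t and exponential means -/

/-- The primitive `y ↦ ∫_0^y φ(t) dt/t` of `φ` with respect to the measure `dt/t`. -/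
noncomputable def haarPrimitive (φ : ℝ → ℝ) (y : ℝ) : ℝ := ∫ t in (0 : ℝ)..y, φ t / t

/-- The mean of `φ` with respect to the exponential distribution of rate `a`. -/
noncomputable def laplaceMean (φ : ℝ → ℝ) (a : ℝ) : ℝ :=
  ∫ t in Ioi (0 : ℝ), a * Real.exp (-(a * t)) * φ t

theorem abs_div_self_le_one {φ : ℝ → ℝ} (hb : ∀ t, |φ t| ≤ |t|) (t : ℝ) : |φ t / t| ≤ 1 := by
  rw [abs_div]; exact div_le_one_of_le₀ (hb t) (abs_nonneg t)

theorem intervalIntegrable_div_self {φ : ℝ → ℝ} (hc : Continuous φ) (hb : ∀ t, |φ t| ≤ |t|)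
    (a b : ℝ) : IntervalIntegrable (fun t => φ t / t) volume a b := by
  refine (intervalIntegrable_const (c := (1 : ℝ))).mono_fun ?_ ?_
  · exact (hc.measurable.div measurable_id).aestronglyMeasurable
  · exact Eventually.of_forall fun t => by
      simpa only [norm_one, Real.norm_eq_abs] using abs_div_self_le_one hb t

theorem abs_haarPrimitive_le {φ : ℝ → ℝ} (hb : ∀ t, |φ t| ≤ |t|) (y : ℝ) :
    |haarPrimitive φ y| ≤ |y| := by
  have := intervalIntegral.norm_integral_le_of_norm_le_const (a := 0) (b := y) (C := 1)
    (f := fun t => φ t / t) fun t _ => abs_div_self_le_one hb t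
  simpa [haarPrimitive] using this

theorem continuous_haarPrimitive {φ : ℝ → ℝ} (hc : Continuous φ) (hb : ∀ t, |φ t| ≤ |t|) :
    Continuous (haarPrimitive φ) :=
  intervalIntegral.continuous_primitive (intervalIntegrable_div_self hc hb) 0

theorem hasDerivAt_haarPrimitive {φ : ℝ → ℝ} (hc : Continuous φ) (hb : ∀ t, |φ t| ≤ |t|) {y : ℝ}
    (hy : y ≠ 0) : HasDerivAt (haarPrimitive φ) (φ y / y) y := by
  refine intervalIntegral.integral_hasDerivAt_right (intervalIntegrable_div_self hc hb _ _) ?_ ?_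
  · exact (hc.measurable.div measurable_id).stronglyMeasurable.stronglyMeasurableAtFilter
  · exact hc.continuousAt.div continuousAt_id hy

theorem haarPrimitive_mul {φ : ℝ → ℝ} {c : ℝ} (hc : c ≠ 0) (y : ℝ) :
    haarPrimitive φ (y * c) = ∫ t in (0 : ℝ)..y, φ (t * c) / t := by
  have h := intervalIntegral.integral_comp_mul_right (a := 0) (b := y) (fun t => φ t / t) hc
  simp only [zero_mul, smul_eq_mul] at h
  rw [haarPrimitive, eq_comm, ← mul_right_inj' (inv_ne_zero hc), ← h,
    ← intervalIntegral.integral_const_mul]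
  refine intervalIntegral.integral_congr fun t _ => ?_
  simp only [div_eq_mul_inv, mul_inv]; ring

theorem haarPrimitive_eq_integral_unit {φ : ℝ → ℝ} {y : ℝ} (hy : y ≠ 0) :
    haarPrimitive φ y = ∫ s in Ioc (0 : ℝ) 1, φ (s * y) / s := by
  have := haarPrimitive_mul (φ := φ) hy 1
  rwa [one_mul, intervalIntegral.integral_of_le zero_le_one] at this

theorem integrableOn_mul_exp_neg_mul {a : ℝ} (ha : 0 < a) :
    IntegrableOn (fun t : ℝ => a * Real.exp (-(a * t)) * t) (Ioi 0) := by
  have h := integrableOn_rpow_mul_exp_neg_mul_rpow (p := 1) (s := 1) (b := a) (by norm_num)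
    (by norm_num) ha
  refine (h.const_mul a).congr ?_
  exact Eventually.of_forall fun t => by simp; ring

/-- The primitive is an average of dilates, ∫_0^1 φ(st) ds/s, and an exponential mean turns a
dilation by s into the rate a/s. Fubini applies because |φ(st)/s| ≤ |t|. -/
theorem laplaceMean_haarPrimitive {φ : ℝ → ℝ} (hc : Continuous φ) (hb : ∀ t, |φ t| ≤ |t|) {a : ℝ}
    (ha : 0 < a) :
    laplaceMean (haarPrimitive φ) a = ∫ s in Ioc (0 : ℝ) 1, laplaceMean φ (a / s) / s := by
  have hint : Integrable (Function.uncurry fun t s : ℝ => a * Real.exp (-(a * t)) * (φ (s * t) / s))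
      ((volume.restrict (Ioi 0)).prod (volume.restrict (Ioc 0 1))) := by
    refine ((integrableOn_mul_exp_neg_mul ha).norm.comp_fst _).mono ?_ ?_
    · refine Measurable.aestronglyMeasurable ?_
      have := hc.measurable
      unfold Function.uncurry
      fun_prop
    · refine Eventually.of_forall fun p => ?_
      simp only [Function.uncurry, norm_mul, Real.norm_eq_abs, abs_div, abs_abs]
      refine mul_le_mul_of_nonneg_left ?_ (by positivity)
      refine div_le_of_le_mul₀ (abs_nonneg _) (abs_nonneg _) ?_
      rw [mul_comm, ← abs_mul]; exact hb _
  have h1 : laplaceMean (haarPrimitive φ) a =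
      ∫ t in Ioi (0 : ℝ), ∫ s in Ioc (0 : ℝ) 1, a * Real.exp (-(a * t)) * (φ (s * t) / s) := by
    refine setIntegral_congr_fun measurableSet_Ioi fun t ht => ?_
    rw [haarPrimitive_eq_integral_unit (ne_of_gt ht), integral_const_mul]
  rw [h1, integral_integral_swap hint]
  refine setIntegral_congr_fun measurableSet_Ioc fun s hs => ?_
  have h2 := integral_comp_mul_right_Ioi
    (fun u => a * Real.exp (-(a / s * u)) * (φ u / s)) 0 hs.1
  have hs0 : s ≠ 0 := hs.1.ne'
  simp only [zero_mul, smul_eq_mul, laplaceMean] at h2 ⊢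
  rw [div_eq_inv_mul, ← integral_const_mul]
  rw [← integral_const_mul] at h2
  convert h2 using 1
  · refine integral_congr_ae (Eventually.of_forall fun t => ?_)
    simp only
    rw [mul_comm s t]
    congr 4
    field_simp
  · refine integral_congr_ae (Eventually.of_forall fun t => ?_)
    simp only
    field_simp

theorem laplaceMean_eq_exp {h : ℝ → ℝ} {a : ℝ} (ha : 0 < a) :
    laplaceMean h a = ∫ u in Ioi (0 : ℝ), Real.exp (-u) * h (u / a) := by
  have h2 := integral_comp_mul_right_Ioi (fun u => a * Real.exp (-u) * h (u / a)) 0 ha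
  simp only [zero_mul, smul_eq_mul] at h2
  rw [← integral_const_mul] at h2
  convert h2 using 1
  · refine integral_congr_ae (Eventually.of_forall fun t => ?_)
    simp only
    rw [mul_div_cancel_right₀ _ ha.ne', mul_comm t a]
  · refine integral_congr_ae (Eventually.of_forall fun t => ?_)
    simp only
    field_simp

theorem integrableOn_exp_neg_Ioi_zero : IntegrableOn (fun u : ℝ => Real.exp (-u)) (Ioi 0) := by
  exact integrableOn_exp_neg_Ioi 0

/-- A bounded function with limit `c` at infinity has exponential means tending to `c`. -/
theorem tendsto_laplaceMean {h : ℝ → ℝ} (hm : Measurable h) {C c : ℝ}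
    (hb : ∀ t, 0 < t → |h t| ≤ C) (hc : Tendsto h atTop (𝓝 c)) :
    Tendsto (laplaceMean h) (𝓝[>] 0) (𝓝 c) := by
  have key : Tendsto (fun a : ℝ => ∫ u in Ioi (0 : ℝ), Real.exp (-u) * h (u / a)) (𝓝[>] 0)
      (𝓝 (∫ u in Ioi (0 : ℝ), Real.exp (-u) * c)) := by
    refine tendsto_integral_filter_of_dominated_convergence (fun u => Real.exp (-u) * C) ?_ ?_
      (integrableOn_exp_neg_Ioi_zero.mul_const C) ?_
    · exact Eventually.of_forall fun a => (by fun_prop : Measurable _).aestronglyMeasurable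
    · filter_upwards [self_mem_nhdsWithin] with a ha
      filter_upwards [ae_restrict_mem measurableSet_Ioi] with u hu
      rw [norm_mul, Real.norm_eq_abs, Real.abs_exp]
      exact mul_le_mul_of_nonneg_left (hb _ (div_pos hu ha)) (Real.exp_pos _).le
    · filter_upwards [ae_restrict_mem measurableSet_Ioi] with u hu
      refine (hc.comp ?_).const_mul _
      exact tendsto_inv_nhdsGT_zero.const_mul_atTop (mem_Ioi.1 hu)
  rw [integral_mul_const, integral_exp_neg_Ioi_zero, one_mul] at key
  refine key.congr' ?_
  filter_upwards [self_mem_nhdsWithin] with a ha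
  exact (laplaceMean_eq_exp ha).symm

/-! ### Euler's constant as an exponential mean of the logarithm -/

/-- Differentiation of the Gamma integral under the integral sign at s = 1, where Γ'(1) = -γ. -/
theorem integral_log_mul_exp_neg :
    ∫ t in Ioi (0 : ℝ), Real.exp (-t) * Real.log t = -Real.eulerMascheroniConstant := by
  have h1 := Complex.hasDerivAt_GammaIntegral (s := 1) (by simp)
  have h2 : HasDerivAt Complex.GammaIntegral (-(Real.eulerMascheroniConstant : ℂ)) 1 := by
    refine Complex.hasDerivAt_Gamma_one.congr_of_eventuallyEq ?_
    have : ∀ᶠ s : ℂ in 𝓝 1, 0 < s.re :=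
      (isOpen_lt continuous_const Complex.continuous_re).mem_nhds (by simp)
    filter_upwards [this] with s hs using (Complex.Gamma_eq_integral hs).symm
  have h3 := h1.unique h2
  rw [← Complex.ofReal_inj, ← integral_complex_ofReal, Complex.ofReal_neg, ← h3]
  refine integral_congr_ae (Eventually.of_forall fun t => ?_)
  simp [mul_comm]

theorem integrableOn_log_mul_exp_neg :
    IntegrableOn (fun t : ℝ => Real.exp (-t) * Real.log t) (Ioi 0) := by
  by_contra h
  have h1 := integral_log_mul_exp_neg
  -- A non-integrable function has integral 0 by convention, which would force γ = 0.
  rw [integral_undef h] at h1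
  linarith [Real.one_half_lt_eulerMascheroniConstant]

theorem abs_log_add_le {a u : ℝ} (ha : 0 < a) (ha1 : a < 1) (hu : 0 < u) :
    |Real.log (a + u)| ≤ |Real.log u| + u := by
  have h1 : Real.log u ≤ Real.log (a + u) := Real.log_le_log hu (by linarith)
  have h2 : Real.log (a + u) ≤ u := (Real.log_le_sub_one_of_pos (by linarith)).trans (by linarith)
  rw [abs_le]
  exact ⟨by linarith [neg_abs_le (Real.log u)], by linarith [abs_nonneg (Real.log u)]⟩

/-- The substitution u = at turns log(1 + t) into log(a + u) - log a, and dominated convergence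
sends a to 0 in the first part. -/
theorem tendsto_laplaceMean_log_one_add :
    Tendsto (fun a => laplaceMean (fun t => Real.log (1 + t)) a + Real.log a) (𝓝[>] 0)
      (𝓝 (-Real.eulerMascheroniConstant)) := by
  have hB : IntegrableOn (fun u : ℝ => Real.exp (-u) * (|Real.log u| + u)) (Ioi 0) := by
    have h1 := integrableOn_log_mul_exp_neg.norm
    have h2 := integrableOn_mul_exp_neg_mul one_pos
    refine (h1.add h2).congr (Eventually.of_forall fun u => ?_)
    simp; ring
  have hbound : ∀ a : ℝ, 0 < a → a < 1 → ∀ᵐ u ∂(volume.restrict (Ioi (0 : ℝ))),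
      ‖Real.exp (-u) * Real.log (a + u)‖ ≤ Real.exp (-u) * (|Real.log u| + u) := by
    intro a ha ha1
    filter_upwards [ae_restrict_mem measurableSet_Ioi] with u hu
    rw [norm_mul, Real.norm_eq_abs, Real.norm_eq_abs, Real.abs_exp]
    exact mul_le_mul_of_nonneg_left (abs_log_add_le ha ha1 hu) (Real.exp_pos _).le
  have hmeas : ∀ a : ℝ, AEStronglyMeasurable (fun u : ℝ => Real.exp (-u) * Real.log (a + u))
      (volume.restrict (Ioi (0 : ℝ))) := fun a =>
    (by fun_prop : Measurable _).aestronglyMeasurable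
  have hev : ∀ᶠ a : ℝ in 𝓝[>] 0, 0 < a ∧ a < 1 := Ioo_mem_nhdsGT one_pos
  have key : Tendsto (fun a : ℝ => ∫ u in Ioi (0 : ℝ), Real.exp (-u) * Real.log (a + u)) (𝓝[>] 0)
      (𝓝 (∫ u in Ioi (0 : ℝ), Real.exp (-u) * Real.log u)) := by
    refine tendsto_integral_filter_of_dominated_convergence
      (fun u => Real.exp (-u) * (|Real.log u| + u)) (Eventually.of_forall hmeas) ?_ hB ?_
    · filter_upwards [hev] with a ha using hbound a ha.1 ha.2
    · filter_upwards [ae_restrict_mem measurableSet_Ioi] with u hu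
      refine Tendsto.const_mul _ (Tendsto.log ?_ (ne_of_gt hu))
      have : Tendsto (fun a : ℝ => a + u) (𝓝 0) (𝓝 (0 + u)) := tendsto_id.add_const u
      rw [zero_add] at this
      exact this.mono_left nhdsWithin_le_nhds
  rw [integral_log_mul_exp_neg] at key
  refine key.congr' ?_
  filter_upwards [hev] with a ha
  have h1 : IntegrableOn (fun u : ℝ => Real.exp (-u) * Real.log (a + u)) (Ioi 0) :=
    Integrable.mono' hB (hmeas a) (hbound a ha.1 ha.2)
  have h2 : IntegrableOn (fun u : ℝ => Real.exp (-u) * Real.log a) (Ioi 0) :=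
    integrableOn_exp_neg_Ioi_zero.mul_const _
  have h3 : laplaceMean (fun t => Real.log (1 + t)) a =
      ∫ u in Ioi (0 : ℝ), (Real.exp (-u) * Real.log (a + u) - Real.exp (-u) * Real.log a) := by
    rw [laplaceMean_eq_exp ha.1]
    refine setIntegral_congr_fun measurableSet_Ioi fun u hu => ?_
    have hu : 0 < u := hu
    have : 1 + u / a = (a + u) / a := by field_simp [ha.1.ne']
    rw [this, Real.log_div (by linarith [ha.1]) ha.1.ne']; ring
  rw [h3, integral_sub h1 h2, integral_mul_const, integral_exp_neg_Ioi_zero]; ring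

/-! ### Exact exponential means of sin, 1 - cos, Si, Cin and T -/

theorem tendsto_exp_neg_mul_mul_bounded {b C : ℝ} (hb : 0 < b) {φ : ℝ → ℝ} (h : ∀ t, |φ t| ≤ C) :
    Tendsto (fun t => Real.exp (-(b * t)) * φ t) atTop (𝓝 0) := by
  have h1 : Tendsto (fun t : ℝ => Real.exp (-(b * t))) atTop (𝓝 0) :=
    Real.tendsto_exp_neg_atTop_nhds_zero.comp (tendsto_id.const_mul_atTop hb)
  have h2 := h1.mul_const C
  rw [zero_mul] at h2
  refine squeeze_zero_norm (fun t => ?_) h2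
  rw [norm_mul, Real.norm_eq_abs, Real.abs_exp]
  exact mul_le_mul_of_nonneg_left (h t) (Real.exp_pos _).le

theorem integrableOn_exp_neg_mul_mul_bounded {b C : ℝ} (hb : 0 < b) {φ : ℝ → ℝ}
    (hm : Measurable φ) (h : ∀ t, |φ t| ≤ C) :
    IntegrableOn (fun t => b * Real.exp (-(b * t)) * φ t) (Ioi 0) := by
  have h1 : IntegrableOn (fun t : ℝ => b * Real.exp (-b * t) * C) (Ioi 0) :=
    ((exp_neg_integrableOn_Ioi 0 hb).const_mul b).mul_const C
  refine Integrable.mono' h1 (by fun_prop : Measurable _).aestronglyMeasurable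
    (Eventually.of_forall fun t => ?_)
  rw [norm_mul, Real.norm_eq_abs, Real.norm_eq_abs, abs_of_pos (by positivity), neg_mul]
  exact mul_le_mul_of_nonneg_left (h t) (by positivity)

theorem hasDerivAt_exp_neg_mul (b t : ℝ) :
    HasDerivAt (fun t : ℝ => Real.exp (-(b * t))) (Real.exp (-(b * t)) * -b) t := by
  have := ((hasDerivAt_id t).const_mul b).neg.exp
  simpa using this

theorem laplaceMean_sin {b : ℝ} (hb : 0 < b) : laplaceMean Real.sin b = b / (b ^ 2 + 1) := by
  have hd : ∀ t ∈ Ici (0 : ℝ), HasDerivAt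
      (fun t => Real.exp (-(b * t)) * (-b / (b ^ 2 + 1) * (b * Real.sin t + Real.cos t)))
      (b * Real.exp (-(b * t)) * Real.sin t) t := by
    intro t _
    refine ((hasDerivAt_exp_neg_mul b t).mul ((((Real.hasDerivAt_sin t).const_mul b).add
      (Real.hasDerivAt_cos t)).const_mul (-b / (b ^ 2 + 1)))).congr_deriv ?_
    simp only [Pi.add_apply]
    field_simp; ring
  rw [laplaceMean, integral_Ioi_of_hasDerivAt_of_tendsto' hd
    (integrableOn_exp_neg_mul_mul_bounded hb Real.measurable_sin Real.abs_sin_le_one)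
    (tendsto_exp_neg_mul_mul_bounded (C := |-b / (b ^ 2 + 1)| * (|b| * 1 + 1)) hb fun t => ?_)]
  · simp; ring
  · rw [abs_mul]
    gcongr
    refine (abs_add_le _ _).trans ?_
    rw [abs_mul]
    gcongr
    exacts [Real.abs_sin_le_one t, Real.abs_cos_le_one t]

theorem abs_one_sub_cos_le_two (t : ℝ) : |1 - Real.cos t| ≤ 2 := by
  rw [abs_le]; constructor <;> linarith [Real.neg_one_le_cos t, Real.cos_le_one t]

theorem laplaceMean_one_sub_cos {b : ℝ} (hb : 0 < b) :
    laplaceMean (fun t => 1 - Real.cos t) b = 1 / (b ^ 2 + 1) := by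
  have hd : ∀ t ∈ Ici (0 : ℝ), HasDerivAt
      (fun t => Real.exp (-(b * t)) *
        (-1 + b / (b ^ 2 + 1) * (b * Real.cos t - Real.sin t)))
      (b * Real.exp (-(b * t)) * (1 - Real.cos t)) t := by
    intro t _
    refine ((hasDerivAt_exp_neg_mul b t).mul (((((Real.hasDerivAt_cos t).const_mul b).sub
      (Real.hasDerivAt_sin t)).const_mul (b / (b ^ 2 + 1))).const_add (-1))).congr_deriv ?_
    simp only [Pi.sub_apply]
    field_simp; ring
  rw [laplaceMean, integral_Ioi_of_hasDerivAt_of_tendsto' hd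
    (integrableOn_exp_neg_mul_mul_bounded hb (by fun_prop) abs_one_sub_cos_le_two)
    (tendsto_exp_neg_mul_mul_bounded (C := 1 + |b / (b ^ 2 + 1)| * (|b| * 1 + 1)) hb fun t => ?_)]
  · simp; field_simp; ring
  · refine (abs_add_le _ _).trans ?_
    rw [abs_neg, abs_one, abs_mul]
    gcongr
    refine (abs_sub _ _).trans ?_
    rw [abs_mul]
    gcongr
    exacts [Real.abs_cos_le_one t, Real.abs_sin_le_one t]

theorem abs_one_sub_cos_le_abs (t : ℝ) : |1 - Real.cos t| ≤ |t| := by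
  rw [abs_of_nonneg (by linarith [Real.cos_le_one t])]
  by_cases h : |t| ≤ 2
  · have h1 := Real.one_sub_sq_div_two_le_cos (x := t)
    nlinarith [sq_abs t, abs_nonneg t]
  · linarith [Real.neg_one_le_cos t]

theorem abs_arctan_le_abs (t : ℝ) : |Real.arctan t| ≤ |t| := by
  have key : ∀ s : ℝ, 0 ≤ s → Real.arctan s ≤ s := fun s hs => by
    have := Real.le_tan (Real.arctan_nonneg.2 hs) (Real.arctan_lt_pi_div_two s)
    rwa [Real.tan_arctan] at this
  rcases le_total 0 t with h | h
  · rw [abs_of_nonneg h, abs_of_nonneg (Real.arctan_nonneg.2 h)]; exact key t h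
  · rw [abs_of_nonpos h, abs_of_nonpos (Real.arctan_le_zero.2 h), ← Real.arctan_neg]
    exact key _ (by linarith)

theorem continuous_sineIntegral : Continuous sineIntegral :=
  continuous_haarPrimitive Real.continuous_sin fun _ => Real.abs_sin_le_abs

theorem abs_sineIntegral_le (y : ℝ) : |sineIntegral y| ≤ |y| :=
  abs_haarPrimitive_le (fun _ => Real.abs_sin_le_abs) y

theorem hasDerivAt_sineIntegral {y : ℝ} (hy : y ≠ 0) :
    HasDerivAt sineIntegral (Real.sin y / y) y :=
  hasDerivAt_haarPrimitive Real.continuous_sin (fun _ => Real.abs_sin_le_abs) hy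

theorem laplaceMean_sineIntegral {a : ℝ} (ha : 0 < a) :
    laplaceMean sineIntegral a = Real.arctan (1 / a) := by
  have h := laplaceMean_haarPrimitive Real.continuous_sin (fun _ => Real.abs_sin_le_abs) ha
  have h2 : ∫ s in (0 : ℝ)..1, a / (a ^ 2 + s ^ 2) = Real.arctan (1 / a) - Real.arctan (0 / a) := by
    refine intervalIntegral.integral_eq_sub_of_hasDerivAt
      (f := fun s => Real.arctan (s / a)) (fun s _ => ?_) ?_
    · refine ((hasDerivAt_id s).div_const a).arctan.congr_deriv ?_
      simp only [id]
      field_simp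
    · refine (Continuous.intervalIntegrable ?_ _ _)
      exact continuous_const.div (by fun_prop) fun s => by positivity
  rw [zero_div, Real.arctan_zero, sub_zero, intervalIntegral.integral_of_le zero_le_one] at h2
  rw [← h2]
  refine h.trans (setIntegral_congr_fun measurableSet_Ioc fun s hs => ?_)
  have hs0 : 0 < s := hs.1
  rw [laplaceMean_sin (div_pos ha hs0)]
  field_simp

theorem laplaceMean_haarPrimitive_one_sub_cos {a : ℝ} (ha : 0 < a) :
    laplaceMean (haarPrimitive fun t => 1 - Real.cos t) a =
      Real.log (a ^ 2 + 1) / 2 - Real.log a := by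
  have h := laplaceMean_haarPrimitive (φ := fun t => 1 - Real.cos t) (by fun_prop)
    abs_one_sub_cos_le_abs ha
  have h2 : ∫ s in (0 : ℝ)..1, s / (a ^ 2 + s ^ 2) =
      Real.log (a ^ 2 + 1 ^ 2) / 2 - Real.log (a ^ 2 + 0 ^ 2) / 2 := by
    refine intervalIntegral.integral_eq_sub_of_hasDerivAt
      (f := fun s => Real.log (a ^ 2 + s ^ 2) / 2) (fun s _ => ?_) ?_
    · have hne : a ^ 2 + s ^ 2 ≠ 0 := by positivity
      refine ((((hasDerivAt_pow 2 s).const_add (a ^ 2)).log hne).div_const 2).congr_deriv ?_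
      field_simp
      norm_num [mul_comm]
    · refine (Continuous.intervalIntegrable ?_ _ _)
      exact continuous_id.div (by fun_prop) fun s => by positivity
  rw [intervalIntegral.integral_of_le zero_le_one] at h2
  have h3 : Real.log (a ^ 2 + 1) / 2 - Real.log a =
      Real.log (a ^ 2 + 1 ^ 2) / 2 - Real.log (a ^ 2 + 0 ^ 2) / 2 := by
    rw [one_pow, zero_pow two_ne_zero, add_zero, Real.log_pow]; push_cast; ring
  rw [h3, ← h2]
  refine h.trans (setIntegral_congr_fun measurableSet_Ioc fun s hs => ?_)
  have hs0 : 0 < s := hs.1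
  rw [laplaceMean_one_sub_cos (div_pos ha hs0)]
  field_simp

theorem laplaceMean_haarPrimitive_sineIntegral {a : ℝ} (ha : 0 < a) :
    laplaceMean (haarPrimitive sineIntegral) a = haarPrimitive Real.arctan (1 / a) := by
  rw [laplaceMean_haarPrimitive continuous_sineIntegral abs_sineIntegral_le ha,
    haarPrimitive_eq_integral_unit (by positivity)]
  refine setIntegral_congr_fun measurableSet_Ioc fun s hs => ?_
  have hs0 : 0 < s := hs.1
  rw [laplaceMean_sineIntegral (div_pos ha hs0)]
  congr 2
  field_simp

/-- Inversion formula for the inverse tangent integral: arctan(1/x) = π/2 - arctan x makes the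
difference of the two sides have zero derivative on x > 0, and it vanishes at x = 1. It exposes the
logarithm in the mean of T as a → 0. -/
theorem haarPrimitive_arctan_inv {a : ℝ} (ha : 0 < a) :
    haarPrimitive Real.arctan (1 / a) =
      haarPrimitive Real.arctan a - Real.pi / 2 * Real.log a := by
  have hK : ∀ y : ℝ, y ≠ 0 → HasDerivAt (haarPrimitive Real.arctan) (Real.arctan y / y) y :=
    fun y hy => hasDerivAt_haarPrimitive Real.continuous_arctan abs_arctan_le_abs hy
  have hd : ∀ x ∈ Ioi (0 : ℝ), HasDerivAt (fun x => haarPrimitive Real.arctan x⁻¹ -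
      haarPrimitive Real.arctan x + Real.pi / 2 * Real.log x) 0 x := by
    intro x hx
    have hx0 : 0 < x := hx
    refine ((((hK x⁻¹ (by positivity)).comp x (hasDerivAt_inv hx0.ne')).sub (hK x hx0.ne')).add
      ((Real.hasDerivAt_log hx0.ne').const_mul (Real.pi / 2))).congr_deriv ?_
    rw [Real.arctan_inv_of_pos hx0]
    field_simp; ring
  have hconst := (convex_Ioi (0 : ℝ)).is_const_of_fderivWithin_eq_zero (𝕜 := ℝ)
    (fun x hx => (hd x hx).differentiableAt.differentiableWithinAt)
    (fun x hx => by
      have := (hd x hx).hasFDerivAt.hasFDerivWithinAt (s := Ioi 0)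
      rw [this.fderivWithin (isOpen_Ioi.uniqueDiffWithinAt hx)]
      ext; simp) (mem_Ioi.2 ha) (mem_Ioi.2 one_pos)
  simp only [inv_one, sub_self, Real.log_one, mul_zero, add_zero] at hconst
  rw [one_div]; linarith

/-! ### Asymptotics of Si, Cin and T at infinity -/

theorem integrableOn_Ioi_of_abs_le_div_sq {f : ℝ → ℝ} {C a : ℝ} (ha : 0 < a)
    (hf : ContinuousOn f (Ioi 0)) (hb : ∀ x, 0 < x → |f x| ≤ C / x ^ 2) :
    IntegrableOn f (Ioi a) := by
  have h1 : IntegrableOn (fun x : ℝ => C * x ^ (-2 : ℝ)) (Ioi a) :=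
    (integrableOn_Ioi_rpow_of_lt (by norm_num) ha).const_mul C
  refine Integrable.mono' h1
    ((hf.mono (Ioi_subset_Ioi ha.le)).aestronglyMeasurable measurableSet_Ioi) ?_
  filter_upwards [ae_restrict_mem measurableSet_Ioi] with x hx
  have hx0 : 0 < x := ha.trans hx
  rw [Real.rpow_neg hx0.le, ← div_eq_mul_inv]
  exact_mod_cast hb x hx0

/-- A function whose derivative is `O(1/x²)` converges at infinity with rate `O(1/x)`. -/
theorem exists_tendsto_of_abs_deriv_le_div_sq {f f' : ℝ → ℝ} {C : ℝ}
    (hd : ∀ x, 0 < x → HasDerivAt f (f' x) x) (hf : ContinuousOn f' (Ioi 0))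
    (hb : ∀ x, 0 < x → |f' x| ≤ C / x ^ 2) :
    ∃ m, Tendsto f atTop (𝓝 m) ∧ ∀ x, 0 < x → |f x - m| ≤ C / x := by
  have hm := tendsto_limUnder_of_hasDerivAt_of_integrableOn_Ioi
    (fun x hx => hd x (one_pos.trans hx)) (integrableOn_Ioi_of_abs_le_div_sq one_pos hf hb)
  refine ⟨_, hm, fun x hx => ?_⟩
  have h1 := integral_Ioi_of_hasDerivAt_of_tendsto' (fun y hy => hd y (hx.trans_le hy))
    (integrableOn_Ioi_of_abs_le_div_sq hx hf hb) hm
  have h2 : IntegrableOn (fun x : ℝ => C * x ^ (-2 : ℝ)) (Ioi x) :=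
    (integrableOn_Ioi_rpow_of_lt (by norm_num) hx).const_mul C
  rw [abs_sub_comm, ← h1, ← Real.norm_eq_abs]
  refine (norm_integral_le_of_norm_le h2 ?_).trans_eq ?_
  · filter_upwards [ae_restrict_mem measurableSet_Ioi] with y hy
    have hy0 : 0 < y := hx.trans hy
    rw [Real.rpow_neg hy0.le, ← div_eq_mul_inv]
    exact_mod_cast hb y hy0
  · rw [integral_const_mul, integral_Ioi_rpow_of_lt (by norm_num) hx]
    norm_num [Real.rpow_neg hx.le]
    field_simp

theorem exists_abs_le_of_tendsto_atTop {h : ℝ → ℝ} {m : ℝ} (hc : ContinuousOn h (Ici 0))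
    (hm : Tendsto h atTop (𝓝 m)) : ∃ C, ∀ t, 0 < t → |h t| ≤ C := by
  have h1 : ∀ᶠ t in atTop, |h t| < |m| + 1 := hm.abs.eventually_lt_const (by linarith)
  obtain ⟨M, hM⟩ := eventually_atTop.1 h1
  obtain ⟨C, hC⟩ := (isCompact_Icc (a := 0) (b := M)).exists_bound_of_continuousOn
    (hc.mono Icc_subset_Ici_self)
  refine ⟨max C (|m| + 1), fun t ht => ?_⟩
  rcases le_total t M with h | h
  · exact (hC t ⟨ht.le, h⟩).trans (le_max_left _ _)
  · exact (hM t h).le.trans (le_max_right _ _)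

theorem integrableOn_exp_mul_of_abs_le_self {φ : ℝ → ℝ} {a : ℝ} (ha : 0 < a) (hm : Measurable φ)
    (hb : ∀ t, 0 < t → |φ t| ≤ t) :
    IntegrableOn (fun t => a * Real.exp (-(a * t)) * φ t) (Ioi 0) := by
  refine Integrable.mono' (integrableOn_mul_exp_neg_mul ha)
    (by fun_prop : Measurable _).aestronglyMeasurable ?_
  filter_upwards [ae_restrict_mem measurableSet_Ioi] with t ht
  rw [norm_mul, Real.norm_eq_abs, Real.norm_eq_abs, abs_of_pos (by positivity)]
  exact mul_le_mul_of_nonneg_left (hb t ht) (by positivity)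

theorem tendsto_log_one_add_sub_log :
    Tendsto (fun t : ℝ => Real.log (1 + t) - Real.log t) atTop (𝓝 0) := by
  have h1 : Tendsto (fun t : ℝ => t⁻¹ + 1) atTop (𝓝 (0 + 1)) :=
    tendsto_inv_atTop_zero.add_const 1
  have h2 := h1.log (by norm_num)
  rw [zero_add, Real.log_one] at h2
  refine h2.congr' ?_
  filter_upwards [eventually_gt_atTop 0] with t ht
  rw [← Real.log_div (by linarith) ht.ne']
  congr 1
  field_simp

/-- An asymptotic expansion `Φ t = c log t + m + o(1)` passes to exponential means. -/
theorem tendsto_laplaceMean_add_log {Φ : ℝ → ℝ} {c m : ℝ} (hc : Continuous Φ)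
    (hb : ∀ t, |Φ t| ≤ |t|) (hm : Tendsto (fun t => Φ t - c * Real.log t) atTop (𝓝 m)) :
    Tendsto (fun a => laplaceMean Φ a + c * Real.log a) (𝓝[>] 0)
      (𝓝 (m - c * Real.eulerMascheroniConstant)) := by
  -- With log(1 + t) in place of log t, the remainder keeps its limit m and is also continuous at 0,
  -- hence bounded on t > 0.
  set h : ℝ → ℝ := fun t => Φ t - c * Real.log (1 + t) with hh
  have h1 : Tendsto h atTop (𝓝 m) := by
    have := hm.sub (tendsto_log_one_add_sub_log.const_mul c)
    rw [mul_zero, sub_zero] at this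
    exact this.congr fun t => by simp only [hh]; ring
  have hcont : ContinuousOn h (Ici 0) := by
    refine hc.continuousOn.sub (continuousOn_const.mul (ContinuousOn.log (by fun_prop) ?_))
    intro t ht
    have : 0 ≤ t := ht
    positivity
  obtain ⟨C, hC⟩ := exists_abs_le_of_tendsto_atTop hcont h1
  have hmeas := hc.measurable
  have h2 := tendsto_laplaceMean (h := h) (by fun_prop) hC h1
  have h3 := h2.add (tendsto_laplaceMean_log_one_add.const_mul c)
  rw [mul_neg, ← sub_eq_add_neg] at h3
  refine h3.congr' ?_
  filter_upwards [self_mem_nhdsWithin] with a ha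
  have i1 := integrableOn_exp_mul_of_abs_le_self (φ := Φ) ha hmeas
    fun t ht => (hb t).trans_eq (abs_of_pos ht)
  have i2 := integrableOn_exp_mul_of_abs_le_self (φ := fun t => Real.log (1 + t)) ha
    (by fun_prop) fun t ht => by
      rw [abs_of_nonneg (Real.log_nonneg (by linarith))]
      linarith [Real.log_le_sub_one_of_pos (show 0 < 1 + t by linarith)]
  have h4 : laplaceMean h a = laplaceMean Φ a - c * laplaceMean (fun t => Real.log (1 + t)) a := by
    unfold laplaceMean
    rw [← integral_const_mul, ← integral_sub i1 (i2.const_mul c)]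
    refine integral_congr_ae (Eventually.of_forall fun t => ?_)
    simp only [hh]; ring
  rw [h4]; ring

theorem tendsto_cos_div_atTop : Tendsto (fun x : ℝ => Real.cos x / x) atTop (𝓝 0) := by
  refine squeeze_zero_norm' ?_ tendsto_inv_atTop_zero
  filter_upwards [eventually_gt_atTop 0] with x hx
  rw [norm_div, Real.norm_eq_abs, Real.norm_eq_abs, abs_of_pos hx, ← one_div]
  gcongr
  exact Real.abs_cos_le_one x

theorem tendsto_sin_div_atTop : Tendsto (fun x : ℝ => Real.sin x / x) atTop (𝓝 0) := by
  refine squeeze_zero_norm' ?_ tendsto_inv_atTop_zero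
  filter_upwards [eventually_gt_atTop 0] with x hx
  rw [norm_div, Real.norm_eq_abs, Real.norm_eq_abs, abs_of_pos hx, ← one_div]
  gcongr
  exact Real.abs_sin_le_one x

theorem abs_div_le_one_div {u x : ℝ} (hx : 0 < x) (hu : |u| ≤ 1) : |u / x| ≤ 1 / x := by
  rw [abs_div, abs_of_pos hx]; gcongr

/-- Adding cos x / x improves the derivative from sin x / x to -cos x / x², so the sum converges
with error at most 1/x; removing cos x / x costs another 1/x. The limit is that of the exponential
mean arctan(1/a). -/
theorem abs_sineIntegral_sub_le {x : ℝ} (hx : 0 < x) :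
    |sineIntegral x - Real.pi / 2| ≤ 2 / x := by
  obtain ⟨m, hm, hb⟩ := exists_tendsto_of_abs_deriv_le_div_sq (C := 1)
    (f := fun x => sineIntegral x + Real.cos x / x) (f' := fun x => -Real.cos x / x ^ 2)
    (fun x hx => ((hasDerivAt_sineIntegral hx.ne').add
      ((Real.hasDerivAt_cos x).div (hasDerivAt_id x) hx.ne')).congr_deriv (by
        simp only [id]; field_simp; ring))
    (ContinuousOn.div (by fun_prop) (by fun_prop) fun x hx => (pow_pos hx 2).ne')
    (fun x hx => abs_div_le_one_div (pow_pos hx 2) (by rw [abs_neg]; exact Real.abs_cos_le_one x))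
  have h1 : Tendsto (fun t => sineIntegral t - 0 * Real.log t) atTop (𝓝 m) := by
    have := hm.sub tendsto_cos_div_atTop
    rw [sub_zero] at this
    exact this.congr fun t => by ring
  have h2 := tendsto_laplaceMean_add_log continuous_sineIntegral abs_sineIntegral_le h1
  have h3 : Tendsto (fun a : ℝ => Real.arctan (1 / a)) (𝓝[>] 0) (𝓝 (Real.pi / 2)) := by
    simp only [one_div]
    exact (Real.tendsto_arctan_atTop.mono_right nhdsWithin_le_nhds).comp tendsto_inv_nhdsGT_zero
  have h4 : m = Real.pi / 2 := by
    rw [zero_mul, sub_zero] at h2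
    refine tendsto_nhds_unique h2 (h3.congr' ?_)
    filter_upwards [self_mem_nhdsWithin] with a ha
    rw [laplaceMean_sineIntegral ha]; ring
  subst h4
  have h5 := hb x hx
  have h6 := abs_div_le_one_div hx (Real.abs_cos_le_one x)
  have h7 : (2 : ℝ) / x = 1 / x + 1 / x := by ring
  rw [abs_le] at *
  constructor <;> linarith [h5.1, h5.2, h6.1, h6.2]

theorem continuous_haarPrimitive_sineIntegral : Continuous (haarPrimitive sineIntegral) :=
  continuous_haarPrimitive continuous_sineIntegral abs_sineIntegral_le

theorem tendsto_haarPrimitive_arctan_zero :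
    Tendsto (haarPrimitive Real.arctan) (𝓝[>] 0) (𝓝 0) := by
  have := (continuous_haarPrimitive Real.continuous_arctan abs_arctan_le_abs).tendsto 0
  rw [show haarPrimitive Real.arctan 0 = 0 by simp [haarPrimitive]] at this
  exact this.mono_left nhdsWithin_le_nhds

theorem tendsto_haarPrimitive_sineIntegral_sub_log :
    Tendsto (fun t => haarPrimitive sineIntegral t - Real.pi / 2 * Real.log t) atTop
      (𝓝 (Real.pi / 2 * Real.eulerMascheroniConstant)) := by
  obtain ⟨m, hm, -⟩ := exists_tendsto_of_abs_deriv_le_div_sq (C := 2)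
    (f := fun t => haarPrimitive sineIntegral t - Real.pi / 2 * Real.log t)
    (f' := fun x => (sineIntegral x - Real.pi / 2) / x)
    (fun x hx => ((hasDerivAt_haarPrimitive continuous_sineIntegral abs_sineIntegral_le hx.ne').sub
      ((Real.hasDerivAt_log hx.ne').const_mul _)).congr_deriv (by field_simp))
    (ContinuousOn.div (continuous_sineIntegral.sub continuous_const).continuousOn (by fun_prop)
      fun x hx => ne_of_gt hx)
    (fun x hx => by
      rw [abs_div, abs_of_pos hx, pow_two, ← div_div]
      gcongr
      exact abs_sineIntegral_sub_le hx)
  have h2 := tendsto_laplaceMean_add_log continuous_haarPrimitive_sineIntegral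
    (abs_haarPrimitive_le abs_sineIntegral_le) hm
  have h4 : (0 : ℝ) = m - Real.pi / 2 * Real.eulerMascheroniConstant := by
    refine tendsto_nhds_unique (tendsto_haarPrimitive_arctan_zero.congr' ?_) h2
    filter_upwards [self_mem_nhdsWithin] with a ha
    rw [laplaceMean_haarPrimitive_sineIntegral ha, haarPrimitive_arctan_inv ha]; ring
  rwa [show m = Real.pi / 2 * Real.eulerMascheroniConstant by linarith] at hm

/-- As for Si, with corrector sin x / x. The constant is γ because log(a² + 1)/2, the mean of Cin
plus log a, tends to 0. -/
theorem abs_haarPrimitive_one_sub_cos_sub_log_sub_le {x : ℝ} (hx : 0 < x) :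
    |haarPrimitive (fun t => 1 - Real.cos t) x - Real.log x - Real.eulerMascheroniConstant|
      ≤ 2 / x := by
  obtain ⟨m, hm, hb⟩ := exists_tendsto_of_abs_deriv_le_div_sq (C := 1)
    (f := fun x => haarPrimitive (fun t => 1 - Real.cos t) x - Real.log x + Real.sin x / x)
    (f' := fun x => -Real.sin x / x ^ 2)
    (fun x hx => (((hasDerivAt_haarPrimitive (by fun_prop) abs_one_sub_cos_le_abs hx.ne').sub
      (Real.hasDerivAt_log hx.ne')).add
      ((Real.hasDerivAt_sin x).div (hasDerivAt_id x) hx.ne')).congr_deriv (by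
        simp only [id]; field_simp; ring))
    (ContinuousOn.div (by fun_prop) (by fun_prop) fun x hx => (pow_pos hx 2).ne')
    (fun x hx => abs_div_le_one_div (pow_pos hx 2) (by rw [abs_neg]; exact Real.abs_sin_le_one x))
  have h1 : Tendsto (fun t => haarPrimitive (fun t => 1 - Real.cos t) t - 1 * Real.log t)
      atTop (𝓝 m) := by
    have := hm.sub tendsto_sin_div_atTop
    rw [sub_zero] at this
    exact this.congr fun t => by ring
  have h2 := tendsto_laplaceMean_add_log
    (continuous_haarPrimitive (by fun_prop) abs_one_sub_cos_le_abs)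
    (abs_haarPrimitive_le abs_one_sub_cos_le_abs) h1
  have h3 : Tendsto (fun a : ℝ => Real.log (a ^ 2 + 1) / 2) (𝓝[>] 0) (𝓝 0) := by
    have : ContinuousAt (fun a : ℝ => Real.log (a ^ 2 + 1) / 2) 0 := by
      refine (ContinuousAt.log (by fun_prop) (by norm_num)).div_const 2
    have := this.tendsto
    norm_num at this
    exact this.mono_left nhdsWithin_le_nhds
  have h4 : (0 : ℝ) = m - 1 * Real.eulerMascheroniConstant := by
    refine tendsto_nhds_unique (h3.congr' ?_) h2
    filter_upwards [self_mem_nhdsWithin] with a ha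
    rw [laplaceMean_haarPrimitive_one_sub_cos ha]; ring
  obtain rfl : m = Real.eulerMascheroniConstant := by linarith
  have h5 := hb x hx
  have h6 := abs_div_le_one_div hx (Real.abs_sin_le_one x)
  have h7 : (2 : ℝ) / x = 1 / x + 1 / x := by ring
  rw [abs_le] at *
  constructor <;> linarith [h5.1, h5.2, h6.1, h6.2]

/-! ### Power series and the two hypergeometric functions -/

theorem HasSum.of_eq {ι : Type*} {f g : ι → ℝ} {a b : ℝ} (h : HasSum f a) (hfg : ∀ n, g n = f n)
    (hab : b = a) : HasSum g b := by
  rwa [funext hfg, hab]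

/-- Termwise integration of an odd power series against `dt/t`. -/
theorem hasSum_haarPrimitive {φ : ℝ → ℝ} {a : ℕ → ℝ}
    (hs : ∀ t, HasSum (fun n => a n * t ^ (2 * n + 1)) (φ t)) (y : ℝ) :
    HasSum (fun n => a n / (2 * n + 1) * y ^ (2 * n + 1)) (haarPrimitive φ y) := by
  have hsum : Summable fun n => |a n| * |y| ^ (2 * n) := by
    rcases eq_or_ne y 0 with rfl | hy
    · refine summable_of_ne_finset_zero (s := {0}) fun n hn => ?_
      have : n ≠ 0 := by simpa using hn
      simp [this]
    · have h := ((hs y).summable.abs).mul_right |y|⁻¹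
      refine h.congr fun n => ?_
      have : |y| ≠ 0 := abs_ne_zero.2 hy
      rw [abs_mul, abs_pow, pow_succ]; field_simp
  have key := intervalIntegral.hasSum_integral_of_dominated_convergence (a := 0) (b := y)
    (μ := volume) (F := fun n t => a n * t ^ (2 * n)) (f := fun t => φ t / t)
    (fun n _ => |a n| * |y| ^ (2 * n)) (fun n => by fun_prop) ?_ ?_ ?_ ?_
  · refine key.of_eq (fun n => ?_) rfl
    rw [intervalIntegral.integral_const_mul, integral_pow]
    push_cast
    rw [zero_pow (by omega)]; ring
  · refine fun n => Eventually.of_forall fun t ht => ?_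
    have : |t| ≤ |y| := by
      have h := abs_sub_left_of_mem_uIcc (uIoc_subset_uIcc ht)
      simpa using h
    rw [norm_mul, norm_pow, Real.norm_eq_abs, Real.norm_eq_abs]
    gcongr
  · exact Eventually.of_forall fun t _ => hsum
  · exact intervalIntegrable_const
  -- At t = 0 the quotient φ t / t is 0 by convention while the series gives `a 0`; this one point
  -- is negligible.
  · have : ∀ᵐ t : ℝ, t ≠ 0 := by simp [ae_iff]
    filter_upwards [this] with t ht _
    refine ((hs t).div_const t).of_eq (fun n => ?_) rfl
    rw [pow_succ]; field_simp

theorem hasSum_sineIntegral (y : ℝ) :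
    HasSum (fun n : ℕ => (-1) ^ n / ((2 * n + 1).factorial : ℝ) / (2 * n + 1) * y ^ (2 * n + 1))
      (sineIntegral y) :=
  hasSum_haarPrimitive (fun t => by
    exact (Real.hasSum_sin t).of_eq (fun n => by ring) rfl) y

theorem hasSum_haarPrimitive_sineIntegral (y : ℝ) :
    HasSum (fun n : ℕ => (-1) ^ n / ((2 * n + 1).factorial : ℝ) / (2 * n + 1) / (2 * n + 1)
      * y ^ (2 * n + 1)) (haarPrimitive sineIntegral y) :=
  hasSum_haarPrimitive hasSum_sineIntegral y

theorem two_mul_sub_one_ne_zero (n : ℕ) : (2 * n - 1 : ℝ) ≠ 0 := by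
  intro h
  have h1 : (2 * n : ℝ) = 1 := by linarith
  have h2 : 2 * n = 1 := by exact_mod_cast h1
  omega

theorem ascPochhammer_eval_half_ne_zero (n : ℕ) : (ascPochhammer ℝ n).eval (1 / 2) ≠ 0 :=
  (ascPochhammer_pos n _ (by norm_num)).ne'

theorem ascPochhammer_eval_neg_half (n : ℕ) :
    (ascPochhammer ℝ n).eval (-1 / 2) = -(ascPochhammer ℝ n).eval (1 / 2) / (2 * n - 1) := by
  induction n with
  | zero => simp
  | succ n ih =>
    have h1 := two_mul_sub_one_ne_zero n
    have h2 := two_mul_sub_one_ne_zero (n + 1)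
    rw [ascPochhammer_succ_eval, ascPochhammer_succ_eval, ih]
    push_cast at h2 ⊢
    field_simp
    ring

theorem ascPochhammer_eval_five_halves (n : ℕ) :
    (ascPochhammer ℝ n).eval (5 / 2) =
      (2 * n + 3) * (2 * n + 1).factorial / (3 * 4 ^ n * n.factorial) := by
  induction n with
  | zero => simp
  | succ n ih =>
    rw [ascPochhammer_succ_eval, ih, show 2 * (n + 1) + 1 = (2 * n + 1) + 1 + 1 by ring,
      Nat.factorial_succ (2 * n + 1 + 1), Nat.factorial_succ (2 * n + 1), Nat.factorial_succ n,
      pow_succ]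
    push_cast
    field_simp
    ring

theorem hypergeometricTerm_one_two (z : ℝ) (n : ℕ) :
    hypergeometricTerm [-1 / 2] [1 / 2, 5 / 2] (-(z ^ 2)) n =
      -3 * (-1) ^ n * (2 * z) ^ (2 * n) / ((2 * n - 1) * (2 * n + 3) * (2 * n + 1).factorial) := by
  have h1 := two_mul_sub_one_ne_zero n
  have h2 := ascPochhammer_eval_half_ne_zero n
  have h3 : (-(z ^ 2)) ^ n * 4 ^ n = (-1) ^ n * (2 * z) ^ (2 * n) := by
    rw [pow_mul, ← mul_pow, ← mul_pow]; ring
  simp only [hypergeometricTerm, List.map_cons, List.map_nil, List.prod_cons, List.prod_nil,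
    mul_one, ascPochhammer_eval_neg_half, ascPochhammer_eval_five_halves]
  rw [mul_assoc (-3), ← h3]
  field_simp

theorem hypergeometricTerm_two_three (z : ℝ) (n : ℕ) :
    hypergeometricTerm [-1 / 2, -1 / 2] [1 / 2, 1 / 2, 5 / 2] (-(z ^ 2)) n =
      3 * (-1) ^ n * (2 * z) ^ (2 * n) /
        ((2 * n - 1) ^ 2 * (2 * n + 3) * (2 * n + 1).factorial) := by
  have h1 := two_mul_sub_one_ne_zero n
  have h2 := ascPochhammer_eval_half_ne_zero n
  have h3 : (-(z ^ 2)) ^ n * 4 ^ n = (-1) ^ n * (2 * z) ^ (2 * n) := by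
    rw [pow_mul, ← mul_pow, ← mul_pow]; ring
  simp only [hypergeometricTerm, List.map_cons, List.map_nil, List.prod_cons, List.prod_nil,
    mul_one, ascPochhammer_eval_neg_half, ascPochhammer_eval_five_halves]
  rw [mul_assoc (3 : ℝ) ((-1) ^ n), ← h3]
  field_simp

/-- Because 1/((2n+3)(2n+1)!) = 1/(2n+2)! - 1/(2n+3)!, the series is a difference of shifted cosine
and sine series; their omitted first terms cancel. -/
theorem hasSum_cos_sub_sin_div (y : ℝ) (hy : y ≠ 0) :
    HasSum (fun n : ℕ => (-1) ^ n * y ^ (2 * n) / ((2 * n + 3) * (2 * n + 1).factorial))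
      (Real.sin y / y ^ 3 - Real.cos y / y ^ 2) := by
  have hs := (hasSum_nat_add_iff' 1).2 (Real.hasSum_sin y)
  have hc := (hasSum_nat_add_iff' 1).2 (Real.hasSum_cos y)
  refine ((hs.div_const (y ^ 3)).sub (hc.div_const (y ^ 2))).of_eq (fun n => ?_) ?_
  · rw [show 2 * (n + 1) + 1 = (2 * n + 1) + 1 + 1 by ring,
      show 2 * (n + 1) = (2 * n + 1) + 1 by ring, Nat.factorial_succ (2 * n + 1 + 1),
      Nat.factorial_succ (2 * n + 1)]
    push_cast
    field_simp
    ring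
  · simp; field_simp; ring

/-- After the shift n → n + 1 the factor 2n - 1 becomes 2n + 1, the denominator in the series of Si;
the remaining partial fractions are sine and cosine coefficients. -/
theorem hasSum_inv_two_mul_sub_one (y : ℝ) (hy : y ≠ 0) :
    HasSum (fun n : ℕ => (-1) ^ n * y ^ (2 * n) / ((2 * n - 1) * (2 * n + 1).factorial))
      (-Real.sin y / (2 * y) - Real.cos y / 2 - y * sineIntegral y / 2) := by
  have hs := (hasSum_nat_add_iff' 1).2 (Real.hasSum_sin y)
  have hc := (hasSum_nat_add_iff' 1).2 (Real.hasSum_cos y)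
  have hi := hasSum_sineIntegral y
  rw [← hasSum_nat_add_iff' 1]
  refine (((hs.mul_left (-1 / (2 * y))).add (hc.mul_left (-1 / 2))).add
    (hi.mul_left (-y / 2))).of_eq (fun n => ?_) ?_
  · rw [show 2 * (n + 1) + 1 = (2 * n + 1) + 1 + 1 by ring,
      show 2 * (n + 1) = (2 * n + 1) + 1 by ring, Nat.factorial_succ (2 * n + 1 + 1),
      Nat.factorial_succ (2 * n + 1)]
    have h : (2 * ((n : ℝ) + 1) - 1) = 2 * n + 1 := by ring
    push_cast
    rw [h]
    field_simp
    ring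
  · simp; field_simp; ring

theorem hasSum_inv_two_mul_sub_one_sq (y : ℝ) (hy : y ≠ 0) :
    HasSum (fun n : ℕ => (-1) ^ n * y ^ (2 * n) / ((2 * n - 1) ^ 2 * (2 * n + 1).factorial))
      (3 / 4 * Real.cos y + Real.sin y / (4 * y) + 3 / 4 * y * sineIntegral y
        - y * haarPrimitive sineIntegral y / 2) := by
  have hs := (hasSum_nat_add_iff' 1).2 (Real.hasSum_sin y)
  have hc := (hasSum_nat_add_iff' 1).2 (Real.hasSum_cos y)
  have hi := hasSum_sineIntegral y
  have ht := hasSum_haarPrimitive_sineIntegral y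
  rw [← hasSum_nat_add_iff' 1]
  refine ((((hs.mul_left (1 / (4 * y))).add (hc.mul_left (3 / 4))).add
    (hi.mul_left (3 / 4 * y))).sub (ht.mul_left (y / 2))).of_eq (fun n => ?_) ?_
  · rw [show 2 * (n + 1) + 1 = (2 * n + 1) + 1 + 1 by ring,
      show 2 * (n + 1) = (2 * n + 1) + 1 by ring, Nat.factorial_succ (2 * n + 1 + 1),
      Nat.factorial_succ (2 * n + 1)]
    have h : (2 * ((n : ℝ) + 1) - 1) = 2 * n + 1 := by ring
    push_cast
    rw [h]
    field_simp
    ring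
  · simp; field_simp; ring

/-- With z = kπ and y = 2z, both coefficients split by 1/((2n-1)(2n+3)) = (1/(2n-1) - 1/(2n+3))/4,
used twice for the double factor 2n - 1. At y = 2πk the sine vanishes and the cosine is 1. -/
theorem hypergeometric_add_three_mul {k : ℕ} (hk : k ≠ 0) :
    hypergeometric [-1 / 2] [1 / 2, 5 / 2] (-((k : ℝ) ^ 2 * Real.pi ^ 2))
        + 3 * hypergeometric [-1 / 2, -1 / 2] [1 / 2, 1 / 2, 5 / 2]
          (-((k : ℝ) ^ 2 * Real.pi ^ 2)) =
      75 / 32 - 21 / (64 * Real.pi ^ 2 * k ^ 2)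
        + 75 / 16 * Real.pi * k * sineIntegral (2 * k * Real.pi)
        - 9 / 4 * Real.pi * k * haarPrimitive sineIntegral (2 * k * Real.pi) := by
  have hk0 : (k : ℝ) ≠ 0 := Nat.cast_ne_zero.2 hk
  have hy : 2 * (k * Real.pi) ≠ 0 := by positivity
  have hA := hasSum_cos_sub_sin_div _ hy
  have h1 := hasSum_inv_two_mul_sub_one _ hy
  have h2 := hasSum_inv_two_mul_sub_one_sq _ hy
  have hcos : Real.cos (2 * (k * Real.pi)) = 1 := by
    rw [show 2 * (k * Real.pi) = k * (2 * Real.pi) by ring, Real.cos_nat_mul_two_pi]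
  have hsin : Real.sin (2 * (k * Real.pi)) = 0 := by
    rw [show 2 * (k * Real.pi) = (2 * k : ℕ) * Real.pi by push_cast; ring, Real.sin_nat_mul_pi]
  rw [hcos, hsin] at hA h1 h2
  have e1 : HasSum (hypergeometricTerm [-1 / 2] [1 / 2, 5 / 2] (-((k : ℝ) ^ 2 * Real.pi ^ 2))) _ :=
    HasSum.of_eq ((hA.sub h1).mul_left (3 / 4)) (fun n => by
      have := two_mul_sub_one_ne_zero n
      rw [← mul_pow, hypergeometricTerm_one_two]
      field_simp
      ring) rfl
  have e2 : HasSum (hypergeometricTerm [-1 / 2, -1 / 2] [1 / 2, 1 / 2, 5 / 2]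
      (-((k : ℝ) ^ 2 * Real.pi ^ 2))) _ :=
    HasSum.of_eq (((hA.sub h1).mul_left (3 / 16)).add (h2.mul_left (3 / 4))) (fun n => by
      have := two_mul_sub_one_ne_zero n
      rw [← mul_pow, hypergeometricTerm_two_three]
      field_simp
      ring) rfl
  rw [hypergeometric, hypergeometric, e1.tsum_eq, e2.tsum_eq, ← mul_assoc]
  field_simp
  ring

/-! ### Each summand as a cosine integral -/

theorem tendsto_log_div_atTop : Tendsto (fun x : ℝ => Real.log x / x) atTop (𝓝 0) :=
  Real.isLittleO_log_id_atTop.tendsto_div_nhds_zero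

theorem tendsto_log_add_one_div_atTop :
    Tendsto (fun x : ℝ => (Real.log x + 1) / x) atTop (𝓝 0) := by
  have := tendsto_log_div_atTop.add tendsto_inv_atTop_zero
  rw [add_zero] at this
  exact this.congr fun x => by ring

theorem tendsto_log_div_sq_atTop : Tendsto (fun x : ℝ => Real.log x / x ^ 2) atTop (𝓝 0) := by
  have := tendsto_log_div_atTop.mul tendsto_inv_atTop_zero
  rw [mul_zero] at this
  exact this.congr fun x => by ring

theorem tendsto_one_sub_two_mul_log_div_cube_atTop :
    Tendsto (fun x : ℝ => (1 - 2 * Real.log x) / x ^ 3) atTop (𝓝 0) := by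
  have h1 := (tendsto_inv_atTop_zero (𝕜 := ℝ)).mul
    (tendsto_inv_atTop_zero.mul tendsto_inv_atTop_zero)
  have h2 := (tendsto_log_div_sq_atTop.mul tendsto_inv_atTop_zero).const_mul 2
  have := h1.sub h2
  simp only [mul_zero, sub_zero] at this
  exact this.congr fun x => by ring

theorem integrableOn_log_kernel :
    IntegrableOn (fun x : ℝ => (5 - 6 * Real.log x) / x ^ 4) (Ioi 1) := by
  have h1 : IntegrableOn (fun x : ℝ => 11 * x ^ (-2 : ℝ)) (Ioi 1) :=
    (integrableOn_Ioi_rpow_of_lt (by norm_num) one_pos).const_mul 11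
  refine Integrable.mono' h1 (by fun_prop : Measurable _).aestronglyMeasurable ?_
  filter_upwards [ae_restrict_mem measurableSet_Ioi] with x hx
  have hx1 : 1 < x := hx
  have hx0 : 0 < x := by linarith
  have hl0 := Real.log_nonneg hx1.le
  have hl1 := Real.log_le_sub_one_of_pos hx0
  rw [Real.rpow_neg hx0.le, ← div_eq_mul_inv, Real.norm_eq_abs, abs_div,
    abs_of_pos (pow_pos hx0 4)]
  norm_cast
  rw [div_le_div_iff₀ (by positivity) (by positivity)]
  have h2 : |5 - 6 * Real.log x| ≤ 11 * x := by
    rw [abs_le]; constructor <;> linarith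
  have h3 : x ≤ x ^ 2 := by nlinarith
  calc |5 - 6 * Real.log x| * x ^ 2 ≤ 11 * x ^ 2 * x ^ 2 := by gcongr; linarith
    _ = 11 * x ^ 4 := by ring

theorem integrableOn_log_kernel_mul_cos (y : ℝ) :
    IntegrableOn (fun x : ℝ => (5 - 6 * Real.log x) / x ^ 4 * Real.cos (y * x)) (Ioi 1) :=
  Integrable.mul_bdd (c := 1) integrableOn_log_kernel
    (by fun_prop : Measurable _).aestronglyMeasurable
    (Eventually.of_forall fun _ => Real.abs_cos_le_one _)

theorem hasDerivAt_one_sub_two_mul_log_div_cube {x : ℝ} (hx : x ≠ 0) :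
    HasDerivAt (fun x => (1 - 2 * Real.log x) / x ^ 3)
      ((-(2 * x⁻¹) * x ^ 3 - (1 - 2 * Real.log x) * (3 * x ^ 2)) / (x ^ 3) ^ 2) x :=
  ((((Real.hasDerivAt_log hx).const_mul 2).const_sub 1).div (hasDerivAt_pow 3 x)
    (pow_ne_zero 3 hx)).congr_deriv (by norm_num)

theorem hasDerivAt_log_div_sq {x : ℝ} (hx : x ≠ 0) :
    HasDerivAt (fun x => Real.log x / x ^ 2)
      ((x⁻¹ * x ^ 2 - Real.log x * (2 * x)) / (x ^ 2) ^ 2) x :=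
  ((Real.hasDerivAt_log hx).div (hasDerivAt_pow 2 x) (pow_ne_zero 2 hx)).congr_deriv (by norm_num)

theorem hasDerivAt_log_add_one_div {x : ℝ} (hx : x ≠ 0) :
    HasDerivAt (fun x => (Real.log x + 1) / x) ((x⁻¹ * x - (Real.log x + 1) * 1) / x ^ 2) x :=
  ((Real.hasDerivAt_log hx).add_const 1).div (hasDerivAt_id x) hx

/-- An antiderivative of `(5 - 6 log x) / x⁴ * cos (y x)`. -/
noncomputable def logKernelPrimitive (y x : ℝ) : ℝ :=
  -((1 - 2 * Real.log x) / x ^ 3 * Real.cos (y * x)) - y * (Real.log x / x ^ 2 * Real.sin (y * x))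
    - y ^ 2 * ((Real.log x + 1) / x * Real.cos (y * x))
    - y ^ 3 * ((Real.log x + 1) * sineIntegral (y * x) - haarPrimitive sineIntegral (y * x))

/-- The primitive comes from integrating by parts four times, through f', f = log x / x² and -(log x
+ 1)/x; in the last step sin(yx)/x is the derivative of Si(yx), and Si(yx)/x that of T(yx). -/
theorem hasDerivAt_logKernelPrimitive {y x : ℝ} (hy : 0 < y) (hx : 0 < x) :
    HasDerivAt (logKernelPrimitive y) ((5 - 6 * Real.log x) / x ^ 4 * Real.cos (y * x)) x := by
  have hxn := hx.ne'
  have hl := Real.hasDerivAt_log hxn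
  have hm : HasDerivAt (fun x => y * x) y x := by simpa using (hasDerivAt_id x).const_mul y
  have hs : HasDerivAt (fun x => Real.sin (y * x)) (Real.cos (y * x) * y) x := hm.sin
  have hc : HasDerivAt (fun x => Real.cos (y * x)) (-Real.sin (y * x) * y) x := hm.cos
  have hyx : y * x ≠ 0 := (mul_pos hy hx).ne'
  have hS : HasDerivAt (fun x => sineIntegral (y * x)) (Real.sin (y * x) / (y * x) * y) x :=
    (hasDerivAt_sineIntegral hyx).comp x hm
  have hT : HasDerivAt (fun x => haarPrimitive sineIntegral (y * x))
      (sineIntegral (y * x) / (y * x) * y) x :=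
    (hasDerivAt_haarPrimitive continuous_sineIntegral abs_sineIntegral_le hyx).comp x hm
  have h1 := hasDerivAt_one_sub_two_mul_log_div_cube hxn
  have h2 := hasDerivAt_log_div_sq hxn
  have h3 := hasDerivAt_log_add_one_div hxn
  refine ((((h1.mul hc).neg.sub ((h2.mul hs).const_mul y)).sub ((h3.mul hc).const_mul (y ^ 2))).sub
    ((((hl.add_const 1).mul hS).sub hT).const_mul (y ^ 3))).congr_deriv ?_
  field_simp
  ring

theorem tendsto_mul_of_abs_le_one {f u : ℝ → ℝ} (hf : Tendsto f atTop (𝓝 0))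
    (hu : ∀ t, |u t| ≤ 1) : Tendsto (fun x => f x * u x) atTop (𝓝 0) := by
  refine squeeze_zero_norm (fun x => ?_) (tendsto_zero_iff_abs_tendsto_zero _ |>.1 hf)
  rw [norm_mul]
  exact mul_le_of_le_one_right (norm_nonneg _) (hu x)

/-- The divergent parts (π/2) log x of (log x + 1) Si(yx) and T(yx) cancel. The rate O(1/x) for Si
is needed since its error is multiplied by log x + 1. -/
theorem tendsto_logKernelPrimitive {y : ℝ} (hy : 0 < y) :
    Tendsto (logKernelPrimitive y) atTop
      (𝓝 (y ^ 3 * (Real.pi / 2) * (Real.eulerMascheroniConstant + Real.log y - 1))) := by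
  have hyx : Tendsto (fun x => y * x) atTop atTop := tendsto_id.const_mul_atTop hy
  have h1 := tendsto_mul_of_abs_le_one tendsto_one_sub_two_mul_log_div_cube_atTop
    (u := fun x => Real.cos (y * x)) fun _ => Real.abs_cos_le_one _
  have h2 := tendsto_mul_of_abs_le_one tendsto_log_div_sq_atTop
    (u := fun x => Real.sin (y * x)) fun _ => Real.abs_sin_le_one _
  have h3 := tendsto_mul_of_abs_le_one tendsto_log_add_one_div_atTop
    (u := fun x => Real.cos (y * x)) fun _ => Real.abs_cos_le_one _
  have h4 : Tendsto (fun x => (Real.log x + 1) * (sineIntegral (y * x) - Real.pi / 2))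
      atTop (𝓝 0) := by
    have h := tendsto_log_add_one_div_atTop.const_mul (2 / y)
    rw [mul_zero] at h
    refine squeeze_zero_norm' ?_ h
    filter_upwards [eventually_ge_atTop 1] with x hx
    have hx0 : 0 < x := by linarith
    have hl := Real.log_nonneg hx
    rw [norm_mul, Real.norm_eq_abs, Real.norm_eq_abs, abs_of_nonneg (by linarith)]
    refine (mul_le_mul_of_nonneg_left (abs_sineIntegral_sub_le (mul_pos hy hx0))
      (by linarith)).trans_eq ?_
    field_simp
  have h5 := tendsto_haarPrimitive_sineIntegral_sub_log.comp hyx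
  have h6 := (((h1.neg.sub (h2.const_mul y)).sub (h3.const_mul (y ^ 2))).sub
    (h4.const_mul (y ^ 3))).add ((h5.add_const
      (Real.pi / 2 * (Real.log y - 1))).const_mul (y ^ 3))
  have e : -0 - y * 0 - y ^ 2 * 0 - y ^ 3 * 0 + y ^ 3 * (Real.pi / 2 * Real.eulerMascheroniConstant
      + Real.pi / 2 * (Real.log y - 1)) =
      y ^ 3 * (Real.pi / 2) * (Real.eulerMascheroniConstant + Real.log y - 1) := by ring
  rw [e] at h6
  refine h6.congr' ?_
  filter_upwards [eventually_gt_atTop 0] with x hx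
  simp only [logKernelPrimitive, Function.comp]
  rw [Real.log_mul hy.ne' hx.ne']
  ring

theorem integral_log_kernel_mul_cos {y : ℝ} (hy : 0 < y) :
    ∫ x in Ioi (1 : ℝ), (5 - 6 * Real.log x) / x ^ 4 * Real.cos (y * x) =
      y ^ 3 * (Real.pi / 2) * (Real.eulerMascheroniConstant + Real.log y - 1)
        - logKernelPrimitive y 1 :=
  integral_Ioi_of_hasDerivAt_of_tendsto'
    (fun _ hx => hasDerivAt_logKernelPrimitive hy (one_pos.trans_le hx))
    (integrableOn_log_kernel_mul_cos y) (tendsto_logKernelPrimitive hy)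

theorem term_eq_integral {k : ℕ} (hk : k ≠ 0) :
    (k : ℝ) * (Real.eulerMascheroniConstant - 1)
      + 13 / (12 * Real.pi ^ 2) * (1 / (2 * Real.pi ^ 2 * (k : ℝ) ^ 2) - 1)
      + 8 / (9 * Real.pi ^ 2) *
        (hypergeometric [-1 / 2] [1 / 2, 5 / 2] (-((k : ℝ) ^ 2 * Real.pi ^ 2))
          + 3 * hypergeometric [-1 / 2, -1 / 2] [1 / 2, 1 / 2, 5 / 2]
              (-((k : ℝ) ^ 2 * Real.pi ^ 2)))
      + (k : ℝ) * Real.log (2 * Real.pi * (k : ℝ))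
      - 13 * (k : ℝ) / (6 * Real.pi) * sineIntegral (2 * (k : ℝ) * Real.pi) =
    1 / (4 * Real.pi ^ 4) * ∫ x in Ioi (1 : ℝ),
      1 / (k : ℝ) ^ 2 * ((5 - 6 * Real.log x) / x ^ 4 * Real.cos (2 * k * Real.pi * x)) := by
  have hk0 : (0 : ℝ) < k := Nat.cast_pos.2 (Nat.pos_of_ne_zero hk)
  have hcos : Real.cos (2 * k * Real.pi) = 1 := by
    rw [show 2 * k * Real.pi = k * (2 * Real.pi) by ring, Real.cos_nat_mul_two_pi]
  rw [integral_const_mul, integral_log_kernel_mul_cos (by positivity), logKernelPrimitive,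
    hypergeometric_add_three_mul hk, show 2 * Real.pi * (k : ℝ) = 2 * k * Real.pi by ring]
  simp only [Real.log_one, mul_one, hcos]
  field_simp
  ring

/-! ### Fourier series of B₂ and Euler–Maclaurin for ∑ log n / n² -/

/-- The `1`-periodic extension of the Bernoulli polynomial `x² - x + 1/6`. -/
noncomputable def periodicBernoulliTwo (x : ℝ) : ℝ := Int.fract x ^ 2 - Int.fract x + 1 / 6

theorem hasSum_cos_periodicBernoulliTwo (x : ℝ) :
    HasSum (fun k : ℕ => 1 / (k : ℝ) ^ 2 * Real.cos (2 * k * Real.pi * x))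
      (Real.pi ^ 2 * periodicBernoulliTwo x) := by
  have h := hasSum_one_div_nat_pow_mul_cos one_ne_zero
    ⟨Int.fract_nonneg x, (Int.fract_lt_one x).le⟩
  refine h.of_eq (fun k => ?_) ?_
  · rw [mul_one]
    congr 1
    have : 2 * Real.pi * k * Int.fract x =
        2 * k * Real.pi * x - ((k * ⌊x⌋ : ℤ) : ℝ) * (2 * Real.pi) := by
      rw [Int.fract]; push_cast; ring
    rw [this, Real.cos_sub_int_mul_two_pi]
  · have h2 := bernoulliFun_two (Int.fract x)
    rw [bernoulliFun] at h2
    rw [mul_one, h2, periodicBernoulliTwo]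
    rw [Nat.factorial_two]
    push_cast
    ring

theorem periodicBernoulliTwo_eq {n : ℕ} {x : ℝ} (hx : x ∈ Icc (n : ℝ) (n + 1)) :
    periodicBernoulliTwo x = (x - n) ^ 2 - (x - n) + 1 / 6 := by
  rcases hx.2.lt_or_eq with h | h
  · have : ⌊x⌋ = n := Int.floor_eq_iff.2 ⟨by exact_mod_cast hx.1, by exact_mod_cast h⟩
    rw [periodicBernoulliTwo, Int.fract, this]; simp
  · have : Int.fract x = 0 := by rw [h]; exact_mod_cast Int.fract_natCast (n + 1)
    rw [periodicBernoulliTwo, this, h]; ring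

theorem measurable_periodicBernoulliTwo : Measurable periodicBernoulliTwo := by
  unfold periodicBernoulliTwo; fun_prop

theorem abs_periodicBernoulliTwo_le_one (x : ℝ) : |periodicBernoulliTwo x| ≤ 1 := by
  have h0 := Int.fract_nonneg x
  have h1 := (Int.fract_lt_one x).le
  rw [periodicBernoulliTwo, abs_le]
  constructor <;> nlinarith

theorem summable_log_div_sq : Summable fun n : ℕ => Real.log n / (n : ℝ) ^ 2 := by
  have h1 : Summable fun n : ℕ => 2 * (n : ℝ) ^ (-(3 / 2) : ℝ) :=
    (Real.summable_nat_rpow.2 (by norm_num)).mul_left 2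
  refine h1.of_nonneg_of_le (fun n => by positivity) fun n => ?_
  rcases n.eq_zero_or_pos with rfl | hn
  · norm_num
  have hn0 : (0 : ℝ) < n := Nat.cast_pos.2 hn
  have h2 := Real.log_le_rpow_div hn0.le (ε := 1 / 2) (by norm_num)
  have h3 : (n : ℝ) ^ (-(3 / 2) : ℝ) = (n : ℝ) ^ (1 / 2 : ℝ) / (n : ℝ) ^ 2 := by
    rw [← Real.rpow_natCast, ← Real.rpow_sub hn0]; norm_num
  rw [h3, div_le_iff₀ (by positivity)]
  field_simp
  linarith

theorem integrableOn_log_kernel_mul_periodicBernoulliTwo :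
    IntegrableOn (fun x : ℝ => (5 - 6 * Real.log x) / x ^ 4 * periodicBernoulliTwo x) (Ioi 1) :=
  Integrable.mul_bdd (c := 1) integrableOn_log_kernel
    measurable_periodicBernoulliTwo.aestronglyMeasurable
    (Eventually.of_forall fun _ => abs_periodicBernoulliTwo_le_one _)

theorem intervalIntegrable_log_kernel_mul_periodicBernoulliTwo {a b : ℝ} (ha : 1 ≤ a) (hb : a ≤ b) :
    IntervalIntegrable (fun x : ℝ => (5 - 6 * Real.log x) / x ^ 4 * periodicBernoulliTwo x)
      volume a b :=
  (intervalIntegrable_iff_integrableOn_Ioc_of_le hb).2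
    (integrableOn_log_kernel_mul_periodicBernoulliTwo.mono_set
      (Ioc_subset_Ioi_self.trans (Ioi_subset_Ioi ha)))

/-- Two integrations by parts against (x-n)² - (x-n) + 1/6, which is 1/6 at both ends with
derivative -1 and 1 there, leave a trapezoidal sum of f, an increment of f', and the integral of
-2f. -/
theorem integral_log_kernel_mul_periodicBernoulliTwo_succ {n : ℕ} (hn : n ≠ 0) :
    ∫ x in (n : ℝ)..(n + 1), (5 - 6 * Real.log x) / x ^ 4 * periodicBernoulliTwo x =
      (Real.log n / n ^ 2 + Real.log (n + 1) / (n + 1) ^ 2)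
      - ((1 - 2 * Real.log (n + 1)) / (n + 1) ^ 3 - (1 - 2 * Real.log n) / n ^ 3) / 6
      + 2 * ((Real.log (n + 1) + 1) / (n + 1) - (Real.log n + 1) / n) := by
  have hn0 : (0 : ℝ) < n := Nat.cast_pos.2 (Nat.pos_of_ne_zero hn)
  have hle : (n : ℝ) ≤ n + 1 := by linarith
  have hn1 : (1 : ℝ) ≤ n := Nat.one_le_cast.2 (Nat.pos_of_ne_zero hn)
  have hd : ∀ x ∈ uIcc (n : ℝ) (n + 1), HasDerivAt (fun x : ℝ =>
      -((x - n) ^ 2 - (x - n) + 1 / 6) * ((1 - 2 * Real.log x) / x ^ 3)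
        + (2 * (x - n) - 1) * (Real.log x / x ^ 2) + 2 * ((Real.log x + 1) / x))
      ((5 - 6 * Real.log x) / x ^ 4 * periodicBernoulliTwo x) x := by
    intro x hx
    rw [uIcc_of_le hle] at hx
    have hxn : x ≠ 0 := (hn0.trans_le hx.1).ne'
    rw [periodicBernoulliTwo_eq hx]
    have h1 := hasDerivAt_one_sub_two_mul_log_div_cube hxn
    have h2 := hasDerivAt_log_div_sq hxn
    have h3 := hasDerivAt_log_add_one_div hxn
    have h4 : HasDerivAt (fun x : ℝ => -((x - n) ^ 2 - (x - n) + 1 / 6))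
        (-(2 * (x - n) - 1)) x := by
      have h := (hasDerivAt_id x).sub_const (n : ℝ)
      exact (((h.pow 2).sub h).add_const (1 / 6)).neg.congr_deriv (by simp)
    have h5 : HasDerivAt (fun x : ℝ => 2 * (x - n) - 1) 2 x := by
      simpa using (((hasDerivAt_id x).sub_const (n : ℝ)).const_mul 2).sub_const 1
    refine (((h4.mul h1).add (h5.mul h2)).add (h3.const_mul 2)).congr_deriv ?_
    field_simp
    ring
  rw [intervalIntegral.integral_eq_sub_of_hasDerivAt hd
    (intervalIntegrable_log_kernel_mul_periodicBernoulliTwo hn1 hle)]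
  ring

theorem integral_log_kernel_mul_periodicBernoulliTwo_nat (N : ℕ) :
    ∫ x in (1 : ℝ)..(N + 1), (5 - 6 * Real.log x) / x ^ 4 * periodicBernoulliTwo x =
      2 * ∑ i ∈ Finset.range (N + 2), Real.log i / (i : ℝ) ^ 2
      - Real.log (N + 1) / (N + 1) ^ 2 - ((1 - 2 * Real.log (N + 1)) / (N + 1) ^ 3 - 1) / 6
      + 2 * ((Real.log (N + 1) + 1) / (N + 1) - 1) := by
  induction N with
  | zero => simp [Finset.sum_range_succ]
  | succ N ih =>
    have h1 : (1 : ℝ) ≤ N + 1 := by linarith [(Nat.cast_nonneg N : (0 : ℝ) ≤ N)]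
    have h := integral_log_kernel_mul_periodicBernoulliTwo_succ (Nat.succ_ne_zero N)
    push_cast at h ⊢
    rw [← intervalIntegral.integral_add_adjacent_intervals
      (intervalIntegrable_log_kernel_mul_periodicBernoulliTwo le_rfl h1)
      (intervalIntegrable_log_kernel_mul_periodicBernoulliTwo h1 (by linarith)), ih, h,
      Finset.sum_range_succ _ (N + 2)]
    push_cast
    ring_nf

/-- The Euler–Maclaurin formula for `∑ log n / n²`. -/
theorem integral_log_kernel_mul_periodicBernoulliTwo :
    ∫ x in Ioi (1 : ℝ), (5 - 6 * Real.log x) / x ^ 4 * periodicBernoulliTwo x =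
      2 * ∑' n : ℕ, Real.log n / (n : ℝ) ^ 2 - 11 / 6 := by
  have hN : Tendsto (fun N : ℕ => (N : ℝ) + 1) atTop atTop :=
    tendsto_atTop_add_const_right _ _ tendsto_natCast_atTop_atTop
  have h1 := intervalIntegral_tendsto_integral_Ioi 1
    integrableOn_log_kernel_mul_periodicBernoulliTwo hN
  simp only [integral_log_kernel_mul_periodicBernoulliTwo_nat] at h1
  have h2 := (summable_log_div_sq.hasSum.tendsto_sum_nat.comp
    (tendsto_add_atTop_nat 2)).const_mul 2
  have h3 := (((h2.sub (tendsto_log_div_sq_atTop.comp hN)).sub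
    (((tendsto_one_sub_two_mul_log_div_cube_atTop.comp hN).sub_const 1).div_const 6))).add
    (((tendsto_log_add_one_div_atTop.comp hN).sub_const 1).const_mul 2)
  rw [tendsto_nhds_unique h1 h3]
  ring

theorem hasSum_integral_log_kernel_mul_cos :
    HasSum (fun k : ℕ => ∫ x in Ioi (1 : ℝ),
        1 / (k : ℝ) ^ 2 * ((5 - 6 * Real.log x) / x ^ 4 * Real.cos (2 * k * Real.pi * x)))
      (Real.pi ^ 2 * (2 * ∑' n : ℕ, Real.log n / (n : ℝ) ^ 2 - 11 / 6)) := by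
  have h := hasSum_integral_of_summable_integral_norm (μ := volume.restrict (Ioi 1))
    (F := fun (k : ℕ) (x : ℝ) =>
      1 / (k : ℝ) ^ 2 * ((5 - 6 * Real.log x) / x ^ 4 * Real.cos (2 * k * Real.pi * x)))
    (fun k => (integrableOn_log_kernel_mul_cos _).const_mul _) ?_
  · refine h.of_eq (fun _ => rfl) ?_
    rw [← integral_log_kernel_mul_periodicBernoulliTwo, ← integral_const_mul]
    refine integral_congr_ae (Eventually.of_forall fun x => ?_)
    have := ((hasSum_cos_periodicBernoulliTwo x).mul_left ((5 - 6 * Real.log x) / x ^ 4)).of_eq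
      (g := fun k : ℕ =>
        1 / (k : ℝ) ^ 2 * ((5 - 6 * Real.log x) / x ^ 4 * Real.cos (2 * k * Real.pi * x)))
      (fun k => by ring) rfl
    simp only [this.tsum_eq]
    ring
  -- The factor 1/k² and |cos| ≤ 1 dominate the L¹ norms by a multiple of ∑ 1/k².
  · refine Summable.of_nonneg_of_le (fun k => integral_nonneg fun x => norm_nonneg _) (fun k => ?_)
      (hasSum_zeta_two.summable.mul_right
        (∫ x in Ioi (1 : ℝ), ‖(5 - 6 * Real.log x) / x ^ 4‖))
    rw [← integral_const_mul]
    refine integral_mono ((integrableOn_log_kernel_mul_cos _).const_mul _).norm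
      (integrableOn_log_kernel.norm.const_mul _) fun x => ?_
    simp only [norm_mul]
    rw [Real.norm_of_nonneg (by positivity : 0 ≤ 1 / (k : ℝ) ^ 2)]
    refine mul_le_mul_of_nonneg_left ?_ (by positivity)
    exact mul_le_of_le_one_right (norm_nonneg _) (Real.abs_cos_le_one _)

/-! ### The Glaisher–Kinkelin constant from the same Fourier series -/

theorem hasSum_one_sub_cos_periodicBernoulliTwo (x : ℝ) :
    HasSum (fun k : ℕ => 1 / (k : ℝ) ^ 2 * (1 - Real.cos (2 * k * Real.pi * x)))
      (Real.pi ^ 2 * (1 / 6 - periodicBernoulliTwo x)) :=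
  (hasSum_zeta_two.sub (hasSum_cos_periodicBernoulliTwo x)).of_eq (fun k => by ring) (by ring)

theorem measurable_one_sixth_sub_periodicBernoulliTwo_div :
    Measurable fun x => (1 / 6 - periodicBernoulliTwo x) / x :=
  (measurable_const.sub measurable_periodicBernoulliTwo).div measurable_id

/-- The numerator is {x}(1 - {x}) ≤ x for x > 0, so the quotient stays bounded at 0. -/
theorem intervalIntegrable_one_sixth_sub_periodicBernoulliTwo_div (n : ℕ) :
    IntervalIntegrable (fun x => (1 / 6 - periodicBernoulliTwo x) / x) volume 0 n := by
  rw [intervalIntegrable_iff_integrableOn_Ioc_of_le n.cast_nonneg]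
  refine Measure.integrableOn_of_bounded (M := 1) (by simp)
    measurable_one_sixth_sub_periodicBernoulliTwo_div.aestronglyMeasurable ?_
  filter_upwards [ae_restrict_mem measurableSet_Ioc] with x hx
  have hx0 : 0 < x := hx.1
  have h0 := Int.fract_nonneg x
  have h1 := (Int.fract_lt_one x).le
  have h2 : Int.fract x ≤ x := by
    rw [Int.fract]
    have : (0 : ℝ) ≤ ⌊x⌋ := by exact_mod_cast Int.floor_nonneg.2 hx0.le
    linarith
  have h3 : 1 / 6 - periodicBernoulliTwo x = Int.fract x * (1 - Int.fract x) := by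
    rw [periodicBernoulliTwo]; ring
  rw [h3, Real.norm_eq_abs, abs_of_nonneg (by have := sub_nonneg.2 h1; positivity),
    div_le_one hx0]
  nlinarith

theorem integral_one_sixth_sub_periodicBernoulliTwo_div_zero_one :
    ∫ x in (0 : ℝ)..1, (1 / 6 - periodicBernoulliTwo x) / x = 1 / 2 := by
  have h : ∫ x in (0 : ℝ)..1, (1 / 6 - periodicBernoulliTwo x) / x = ∫ x in (0 : ℝ)..1, (1 - x) := by
    rw [intervalIntegral.integral_of_le zero_le_one, intervalIntegral.integral_of_le zero_le_one]
    refine setIntegral_congr_fun measurableSet_Ioc fun x hx => ?_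
    have hx0 : x ≠ 0 := hx.1.ne'
    have := periodicBernoulliTwo_eq (n := 0) (x := x) (by simpa using ⟨hx.1.le, hx.2⟩)
    simp only [this, Nat.cast_zero]
    field_simp
    ring
  rw [h, intervalIntegral.integral_sub (by simp) (by simp)]
  norm_num

theorem integral_one_sixth_sub_periodicBernoulliTwo_div_succ {n : ℕ} (hn : n ≠ 0) :
    ∫ x in (n : ℝ)..(n + 1), (1 / 6 - periodicBernoulliTwo x) / x =
      (2 * n + 1) / 2 - (n ^ 2 + n) * (Real.log (n + 1) - Real.log n) := by
  have hn0 : (0 : ℝ) < n := Nat.cast_pos.2 (Nat.pos_of_ne_zero hn)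
  have hle : (n : ℝ) ≤ n + 1 := by linarith
  have hd : ∀ x ∈ uIcc (n : ℝ) (n + 1), HasDerivAt
      (fun x : ℝ => (2 * n + 1) * x - x ^ 2 / 2 - (n ^ 2 + n) * Real.log x)
      ((1 / 6 - periodicBernoulliTwo x) / x) x := by
    intro x hx
    rw [uIcc_of_le hle] at hx
    have hxn : x ≠ 0 := (hn0.trans_le hx.1).ne'
    rw [periodicBernoulliTwo_eq hx]
    refine ((((hasDerivAt_id x).const_mul (2 * (n : ℝ) + 1)).sub
      ((hasDerivAt_pow 2 x).div_const 2)).sub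
      ((Real.hasDerivAt_log hxn).const_mul ((n : ℝ) ^ 2 + n))).congr_deriv ?_
    field_simp
    norm_num
    ring
  have hi := (intervalIntegrable_one_sixth_sub_periodicBernoulliTwo_div (n + 1)).mono_set
    (c := n) (d := n + 1) (by
      push_cast
      rw [uIcc_of_le hle, uIcc_of_le (by linarith)]
      exact Icc_subset_Icc_left hn0.le)
  rw [intervalIntegral.integral_eq_sub_of_hasDerivAt hd hi]
  ring

theorem log_glaisherSeq_succ_sub {n : ℕ} (hn : n ≠ 0) :
    Real.log (glaisherSeq (n + 1)) = Real.log (glaisherSeq n) + (2 * n + 1) / 4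
      - (n ^ 2 + n) / 2 * (Real.log (n + 1) - Real.log n)
      - (Real.log (n + 1) - Real.log n) / 12 := by
  have hlog : ∀ m : ℕ, m ≠ 0 → Real.log (glaisherSeq m) = Real.log (hyperfactorial m)
      - ((m : ℝ) ^ 2 / 2 + m / 2 + 1 / 12) * Real.log m + (m : ℝ) ^ 2 / 4 := by
    intro m hm
    have hm0 : (0 : ℝ) < m := Nat.cast_pos.2 (Nat.pos_of_ne_zero hm)
    have hH : (hyperfactorial m : ℝ) ≠ 0 := by
      refine Nat.cast_ne_zero.2 (Finset.prod_ne_zero_iff.2 fun k hk => ?_)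
      exact pow_ne_zero _ (by have := (Finset.mem_Icc.1 hk).1; omega)
    have hr := (Real.rpow_pos_of_pos hm0 ((m : ℝ) ^ 2 / 2 + (m : ℝ) / 2 + 1 / 12)).ne'
    rw [glaisherSeq, Real.log_mul (div_ne_zero hH hr) (Real.exp_ne_zero _), Real.log_div hH hr,
      Real.log_exp, Real.log_rpow hm0]
  have hH : Real.log (hyperfactorial (n + 1)) =
      Real.log (hyperfactorial n) + (n + 1) * Real.log (n + 1) := by
    have hne : (hyperfactorial n : ℝ) ≠ 0 := by
      refine Nat.cast_ne_zero.2 (Finset.prod_ne_zero_iff.2 fun k hk => ?_)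
      exact pow_ne_zero _ (by have := (Finset.mem_Icc.1 hk).1; omega)
    rw [hyperfactorial, Finset.prod_Icc_succ_top (by omega), ← hyperfactorial]
    push_cast
    rw [Real.log_mul hne (by positivity), Real.log_pow]
    push_cast
    ring
  rw [hlog _ (Nat.succ_ne_zero n), hlog _ hn, hH]
  push_cast
  ring

theorem log_glaisherSeq_one : Real.log (glaisherSeq 1) = 1 / 4 := by
  simp [glaisherSeq, hyperfactorial]

/-- On [n, n+1] the integrand is (x-n)(n+1-x)/x = 2n + 1 - x - (n² + n)/x, whose integral reproduces
the increment of the logarithm; at N = 1 both sides are 1/4. -/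
theorem log_glaisherSeq_eq {N : ℕ} (hN : N ≠ 0) :
    Real.log (glaisherSeq N) =
      (∫ x in (0 : ℝ)..N, (1 / 6 - periodicBernoulliTwo x) / x) / 2 - Real.log N / 12 := by
  induction N with
  | zero => exact absurd rfl hN
  | succ n ih =>
    rcases eq_or_ne n 0 with rfl | hn
    · rw [zero_add, log_glaisherSeq_one, Nat.cast_one,
        integral_one_sixth_sub_periodicBernoulliTwo_div_zero_one, Real.log_one]
      norm_num
    · have h0 := intervalIntegrable_one_sixth_sub_periodicBernoulliTwo_div n
      have h1 := intervalIntegrable_one_sixth_sub_periodicBernoulliTwo_div (n + 1)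
      rw [← intervalIntegral.integral_add_adjacent_intervals h0 (h0.symm.trans h1),
        log_glaisherSeq_succ_sub hn, ih hn]
      push_cast
      rw [integral_one_sixth_sub_periodicBernoulliTwo_div_succ hn]
      ring

theorem abs_tsum_le_of_hasSum {f g : ℕ → ℝ} {b : ℝ} (hg : HasSum g b) (h : ∀ n, |f n| ≤ g n) :
    |∑' n, f n| ≤ b := by
  rw [← Real.norm_eq_abs]
  exact tsum_of_norm_bounded hg h

theorem abs_integral_one_sixth_sub_periodicBernoulliTwo_div_sub_le {N : ℕ} (hN : N ≠ 0) :
    |Real.pi ^ 2 * (∫ x in (0 : ℝ)..N, (1 / 6 - periodicBernoulliTwo x) / x) -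
      (Real.pi ^ 2 / 6 * (Real.log (2 * Real.pi) + Real.log N + Real.eulerMascheroniConstant)
        + ∑' n : ℕ, Real.log n / (n : ℝ) ^ 2)| ≤ Real.pi ^ 2 / 6 / N := by
  have hN0 : (0 : ℝ) < N := Nat.cast_pos.2 (Nat.pos_of_ne_zero hN)
  set Cin := haarPrimitive fun t => 1 - Real.cos t with hCin
  set e : ℕ → ℝ := fun k => 1 / (k : ℝ) ^ 2 * Cin (2 * k * Real.pi * N)
    - (1 / (k : ℝ) ^ 2 * (Real.log (2 * Real.pi) + Real.log N + Real.eulerMascheroniConstant)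
      + Real.log k / (k : ℝ) ^ 2) with he
  have hmain := (hasSum_zeta_two.mul_right
    (Real.log (2 * Real.pi) + Real.log N + Real.eulerMascheroniConstant)).add
    summable_log_div_sq.hasSum
  have hbound : HasSum (fun k : ℕ => 1 / (k : ℝ) ^ 2 * (1 / N)) (Real.pi ^ 2 / 6 / N) :=
    (hasSum_zeta_two.mul_right (1 / (N : ℝ))).of_eq (fun _ => rfl) (by ring)
  -- The error of Cin at 2πkN is at most 2/(2πkN), hence at most 1/N; the term k = 0 vanishes
  -- because division by 0 gives 0.
  have hle : ∀ k, |e k| ≤ 1 / (k : ℝ) ^ 2 * (1 / N) := by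
    intro k
    rcases eq_or_ne k 0 with rfl | hk
    · simp [he]
    have hk0 : (0 : ℝ) < k := Nat.cast_pos.2 (Nat.pos_of_ne_zero hk)
    have hk1 : (1 : ℝ) ≤ k := Nat.one_le_cast.2 (Nat.pos_of_ne_zero hk)
    have hy : 0 < 2 * k * Real.pi * N := by positivity
    have h1 := abs_haarPrimitive_one_sub_cos_sub_log_sub_le hy
    have h2 : Real.log (2 * k * Real.pi * N) = Real.log (2 * Real.pi) + Real.log k + Real.log N := by
      rw [← Real.log_mul (by positivity) hk0.ne', ← Real.log_mul (by positivity) hN0.ne']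
      congr 1; ring
    have h3 : e k = 1 / (k : ℝ) ^ 2 * (Cin (2 * k * Real.pi * N)
        - Real.log (2 * k * Real.pi * N) - Real.eulerMascheroniConstant) := by
      rw [h2]; simp only [he]; ring
    rw [h3, abs_mul, abs_of_pos (by positivity : 0 < 1 / (k : ℝ) ^ 2)]
    gcongr
    refine h1.trans ?_
    rw [div_le_div_iff₀ hy hN0]
    have h4 : 1 ≤ k * Real.pi := by nlinarith [Real.pi_gt_three]
    nlinarith
  have hes : Summable e := Summable.of_norm_bounded hbound.summable hle
  have hsum : HasSum (fun k : ℕ => 1 / (k : ℝ) ^ 2 * Cin (2 * k * Real.pi * N)) _ :=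
    (hes.hasSum.add hmain).of_eq (fun k => by simp only [he]; ring) rfl
  have hint : ∀ k : ℕ, ∫ x in Ioc (0 : ℝ) N,
      1 / (k : ℝ) ^ 2 * ((1 - Real.cos (2 * k * Real.pi * x)) / x) =
        1 / (k : ℝ) ^ 2 * Cin (2 * k * Real.pi * N) := by
    intro k
    rcases eq_or_ne k 0 with rfl | hk
    · simp
    have hk0 : (0 : ℝ) < k := Nat.cast_pos.2 (Nat.pos_of_ne_zero hk)
    rw [integral_const_mul, mul_comm (2 * k * Real.pi) (N : ℝ), hCin,
      haarPrimitive_mul (by positivity), intervalIntegral.integral_of_le hN0.le]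
    simp only [mul_comm]
  have hI := hasSum_integral_of_summable_integral_norm (μ := volume.restrict (Ioc (0 : ℝ) N))
    (F := fun (k : ℕ) (x : ℝ) => 1 / (k : ℝ) ^ 2 * ((1 - Real.cos (2 * k * Real.pi * x)) / x))
    (fun k => ?_) ?_
  · have hval : HasSum (fun k : ℕ => 1 / (k : ℝ) ^ 2 * Cin (2 * k * Real.pi * N))
        (Real.pi ^ 2 * ∫ x in (0 : ℝ)..N, (1 / 6 - periodicBernoulliTwo x) / x) := by
      refine hI.of_eq (fun k => (hint k).symm) ?_
      rw [intervalIntegral.integral_of_le hN0.le, ← integral_const_mul]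
      refine integral_congr_ae (Eventually.of_forall fun x => ?_)
      have := ((hasSum_one_sub_cos_periodicBernoulliTwo x).div_const x).of_eq
        (g := fun k : ℕ => 1 / (k : ℝ) ^ 2 * ((1 - Real.cos (2 * k * Real.pi * x)) / x))
        (fun k => by ring) rfl
      simp only [this.tsum_eq]
      ring
    rw [hval.unique hsum]
    refine le_trans (le_of_eq ?_) (abs_tsum_le_of_hasSum hbound hle)
    congr 1
    ring
  · refine Integrable.const_mul ?_ _
    refine Measure.integrableOn_of_bounded (M := |2 * k * Real.pi|) (by simp)
      (by fun_prop : Measurable _).aestronglyMeasurable (Eventually.of_forall fun x => ?_)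
    rw [norm_div, Real.norm_eq_abs, Real.norm_eq_abs]
    refine div_le_of_le_mul₀ (abs_nonneg _) (abs_nonneg _) ?_
    rw [← abs_mul]
    exact abs_one_sub_cos_le_abs _
  -- The integrands are nonnegative, so the series of L¹ norms is the series of integrals, already
  -- known to converge.
  · refine hsum.summable.congr fun k => ?_
    rw [← hint]
    refine (setIntegral_congr_fun measurableSet_Ioc fun x hx => ?_).symm
    refine Real.norm_of_nonneg ?_
    have h1 := sub_nonneg.2 (Real.cos_le_one (2 * k * Real.pi * x))
    have h2 : 0 < x := hx.1
    positivity

theorem tendsto_log_glaisherSeq :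
    Tendsto (fun N => Real.log (glaisherSeq N)) atTop
      (𝓝 ((Real.log (2 * Real.pi) + Real.eulerMascheroniConstant) / 12
        + (∑' n : ℕ, Real.log n / (n : ℝ) ^ 2) / (2 * Real.pi ^ 2))) := by
  rw [tendsto_iff_norm_sub_tendsto_zero]
  have h : Tendsto (fun N : ℕ => (1 / 12 : ℝ) / N) atTop (𝓝 0) :=
    tendsto_const_div_atTop_nhds_zero_nat _
  refine squeeze_zero' (Eventually.of_forall fun N => norm_nonneg _) ?_ h
  filter_upwards [eventually_ne_atTop 0] with N hN
  have h1 := abs_integral_one_sixth_sub_periodicBernoulliTwo_div_sub_le hN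
  have hpi := Real.pi_pos
  have hN0 : (0 : ℝ) < N := Nat.cast_pos.2 (Nat.pos_of_ne_zero hN)
  rw [log_glaisherSeq_eq hN, Real.norm_eq_abs]
  have h2 : ∀ D L S γ l : ℝ, D / 2 - l / 12 - ((L + γ) / 12 + S / (2 * Real.pi ^ 2)) =
      (1 / (2 * Real.pi ^ 2)) * (Real.pi ^ 2 * D - (Real.pi ^ 2 / 6 * (L + l + γ) + S)) := by
    intros; field_simp; ring
  rw [h2, abs_mul, abs_of_pos (by positivity)]
  refine (mul_le_mul_of_nonneg_left h1 (by positivity)).trans_eq ?_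
  field_simp
  norm_num

theorem glaisherSeq_pos {N : ℕ} (hN : N ≠ 0) : 0 < glaisherSeq N := by
  have hN0 : (0 : ℝ) < N := Nat.cast_pos.2 (Nat.pos_of_ne_zero hN)
  have hH : 0 < hyperfactorial N :=
    Finset.prod_pos fun k hk => pow_pos (Finset.mem_Icc.1 hk).1 _
  have : (0 : ℝ) < hyperfactorial N := Nat.cast_pos.2 hH
  rw [glaisherSeq]
  positivity

theorem tendsto_glaisherSeq :
    Tendsto glaisherSeq atTop
      (𝓝 (Real.exp ((Real.log (2 * Real.pi) + Real.eulerMascheroniConstant) / 12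
        + (∑' n : ℕ, Real.log n / (n : ℝ) ^ 2) / (2 * Real.pi ^ 2)))) := by
  refine ((Real.continuous_exp.tendsto _).comp tendsto_log_glaisherSeq).congr' ?_
  filter_upwards [eventually_ne_atTop 0] with N hN
  exact Real.exp_log (glaisherSeq_pos hN)

theorem glaisherKinkelin_eq :
    glaisherKinkelin = Real.exp ((Real.log (2 * Real.pi) + Real.eulerMascheroniConstant) / 12
        + (∑' n : ℕ, Real.log n / (n : ℝ) ^ 2) / (2 * Real.pi ^ 2)) :=
  tendsto_glaisherSeq.limUnder_eq

end

theorem mainTheorem2 :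
    (0 < glaisherKinkelin ∧ Filter.Tendsto glaisherSeq Filter.atTop (nhds glaisherKinkelin)) ∧
    HasSum
      (fun k : ℕ+ =>
        (k : ℝ) * (Real.eulerMascheroniConstant - 1)
          + 13 / (12 * Real.pi ^ 2) * (1 / (2 * Real.pi ^ 2 * (k : ℝ) ^ 2) - 1)
          + 8 / (9 * Real.pi ^ 2) *
            (hypergeometric [-1 / 2] [1 / 2, 5 / 2] (-((k : ℝ) ^ 2 * Real.pi ^ 2))
              + 3 * hypergeometric [-1 / 2, -1 / 2] [1 / 2, 1 / 2, 5 / 2]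
                  (-((k : ℝ) ^ 2 * Real.pi ^ 2)))
          + (k : ℝ) * Real.log (2 * Real.pi * (k : ℝ))
          - 13 * (k : ℝ) / (6 * Real.pi) * sineIntegral (2 * (k : ℝ) * Real.pi))
      (Real.log glaisherKinkelin
        - 1 / 12 * (Real.log (2 * Real.pi) + Real.eulerMascheroniConstant
            + 11 / (2 * Real.pi ^ 2))) := by
  refine ⟨⟨?_, ?_⟩, ?_⟩
  · rw [glaisherKinkelin_eq]; exact Real.exp_pos _
  · rw [glaisherKinkelin_eq]; exact tendsto_glaisherSeq
  · have h := hasSum_integral_log_kernel_mul_cos.mul_left (1 / (4 * Real.pi ^ 4))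
    -- Passing from ℕ to positive k loses nothing: the term at 0 carries the factor 1/0² = 0.
    have h1 := (PNat.coe_injective.hasSum_iff fun n hn => by
      have : n = 0 := by
        by_contra h0
        exact hn ⟨⟨n, Nat.pos_of_ne_zero h0⟩, rfl⟩
      simp [this]).2 h
    refine h1.of_eq (fun k => term_eq_integral k.ne_zero) ?_
    rw [glaisherKinkelin_eq, Real.log_exp]
    field_simp
    ring
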